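/- Let $\mathcal L^\infty=\operatorname{colim}_I\mathcal L^\infty_I$ be the quasi-local C*-algebra over $\mathbb Z$ with local algebras $\mathcal L^\infty_I=\mathcal B(\ell^2(\mathbb N)^{\otimes I})$ for bounded intervals $I\subseteq\mathbb Z$; the colimit is that of C*-algebras along the maps $T\mapsto T\otimes 1$. For a bounded interval $I$ let $\mathcal L^\infty_{I^c}$ be the C*-subalgebra generated by the $\mathcal L^\infty_J$ with $J$ a bounded interval disjoint from $I$. A DHR bimodule of $\mathcal L^\infty$ is an $\mathcal L^\infty$-$\mathcal L^\infty$ correspondence $X$ (a right Hilbert C*-module over $\mathcal L^\infty$ with a unital left action of $\mathcal L^\infty$ by adjointable operators) such that for every sufficiently long bounded interval $I$ there is a finite projective basis $b_1,\dots,b_n$ of $X$ (that is, $x=\sum_i b_i\langle b_i\,|\,x\rangle$ for all $x\in X$) with $ab_i=b_ia$ for all $a\in\mathcal L^\infty_{I^c}$ and all $i$. With adjointable bimodule maps as morphisms and the relative tensor product $\boxtimes_{\mathcal L^\infty}$, the DHR bimodules form a C*-tensor category $\mathrm{DHR}(\mathcal L^\infty)$; let $\mathrm{DHR}_0(\mathcal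 L^\infty)$ be its full subcategory of dualizable objects. Its DHR braiding is the braiding that maps $x\boxtimes y$ to $y\boxtimes x$ whenever $x\in X$ commutes with $\mathcal L^\infty_{I^c}$ and $y\in Y$ commutes with $\mathcal L^\infty_{J^c}$ for bounded intervals $I,J$ with $J$ sufficiently far to the right of $I$ (how far may depend on $X$ and $Y$). Then: 1. For every $X\in\mathrm{DHR}_0(\mathcal L^\infty)$ there are an integer $k\ge 0$ and a unitary isomorphism of correspondences $X\cong(\mathcal L^\infty)^{\oplus k}$. 2. The DHR braiding on $\mathrm{DHR}_0(\mathcal L^\infty)$ exists, and there is a $\mathbb C$-linear unitary braided tensor equivalence $\mathrm{DHR}_0(\mathcal L^\infty)\cong\mathrm{Hilb}_{f.d.}$, where $\mathrm{Hilb}_{f.d.}$ is the category of finite-dimensional complex Hilbert spaces and linear maps with its usual tensor product, adjoint and flip braiding. -/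

import Mathlib

open scoped InnerProductSpace ENNReal TensorProduct
open CategoryTheory MulOpposite
set_option linter.unusedSectionVars false
noncomputable section
namespace RotorChain

/-- The Hilbert space `ℓ²(α)`. For a finite set `F` of sites, `ℓ²(F → ℕ)` is the Hilbert space tensor
power `ℓ²(ℕ)^{⊗F}`, with `e_{n₁} ⊗ ⋯ ⊗ e_{nₖ}` identified with `e_{(n₁, …, nₖ)}`. -/
abbrev L2 (α : Type) : Type := lp (fun _ : α => ℂ) 2

section Amplification
variable {α β γ : Type} (e : γ ≃ α × β)

/-- For `ℓ²(γ) = ℓ²(α) ⊗ ℓ²(β)`, the component `(1 ⊗ ⟨e_b|) ξ` of `ξ`. -/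
def slice (b : β) (ξ : L2 γ) : L2 α :=
  ⟨fun a => ξ (e.symm (a, b)), by
    have h := (memℓp_gen_iff (by norm_num : 0 < (2 : ℝ≥0∞).toReal)).1 (lp.memℓp ξ)
    exact (memℓp_gen_iff (by norm_num : 0 < (2 : ℝ≥0∞).toReal)).2
      (h.comp_injective (i := fun a => e.symm (a, b))
        (fun a a' haa => (Prod.ext_iff.1 (e.symm.injective haa)).1))⟩

theorem hasSum_inner_slice (ξ η : L2 γ) :
    HasSum (fun b => ⟪slice e b ξ, slice e b η⟫_ℂ) ⟪ξ, η⟫_ℂ := by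
  have h := lp.hasSum_inner (𝕜 := ℂ) ξ η
  have h' := ((Equiv.prodComm β α).trans e.symm).hasSum_iff.2 h
  exact h'.prod_fiberwise fun b => lp.hasSum_inner (𝕜 := ℂ) (slice e b ξ) (slice e b η)

theorem hasSum_norm_slice (ξ : L2 γ) :
    HasSum (fun b => ‖slice e b ξ‖ ^ 2) (‖ξ‖ ^ 2) := by
  have h := Complex.hasSum_re (hasSum_inner_slice e ξ ξ)
  simpa only [← RCLike.re_eq_complex_re, inner_self_eq_norm_sq] using h

theorem ampl_aux (S : L2 α →L[ℂ] L2 α) (ξ : L2 γ) :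
    HasSum (fun c => ‖S (slice e (e c).2 ξ) (e c).1‖ ^ 2) (∑' b, ‖S (slice e b ξ)‖ ^ 2) := by
  have hs : Summable (fun b => ‖S (slice e b ξ)‖ ^ 2) :=
    Summable.of_nonneg_of_le (fun _ => by positivity)
      (fun b => by
        calc ‖S (slice e b ξ)‖ ^ 2 ≤ (‖S‖ * ‖slice e b ξ‖) ^ 2 := by
              gcongr; exact S.le_opNorm _
          _ = ‖S‖ ^ 2 * ‖slice e b ξ‖ ^ 2 := by ring)
      ((hasSum_norm_slice e ξ).summable.mul_left (‖S‖ ^ 2))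
  have hf : ∀ b, HasSum (fun a => ‖S (slice e b ξ) a‖ ^ 2) (‖S (slice e b ξ)‖ ^ 2) := fun b => by
    have := lp.hasSum_norm (by norm_num : 0 < (2 : ℝ≥0∞).toReal) (S (slice e b ξ))
    simpa using this
  rw [← ((Equiv.prodComm β α).trans e.symm).hasSum_iff]
  have hsum : Summable (fun p : β × α => ‖S (slice e p.1 ξ) p.2‖ ^ 2) := by
    rw [summable_prod_of_nonneg (fun _ => by positivity)]
    exact ⟨fun b => (hf b).summable, by simpa only [(hf _).tsum_eq] using hs⟩
  have := hsum.hasSum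
  rw [hsum.tsum_prod' fun b => (hf b).summable] at this
  simp only [(hf _).tsum_eq] at this
  simpa [Function.comp_def] using this

/-- `(S ⊗ 1) ξ`. -/
def amplFun (S : L2 α →L[ℂ] L2 α) (ξ : L2 γ) : L2 γ :=
  ⟨fun c => S (slice e (e c).2 ξ) (e c).1,
    (memℓp_gen_iff (by norm_num : 0 < (2 : ℝ≥0∞).toReal)).2
      (by simpa using (ampl_aux e S ξ).summable)⟩

theorem slice_amplFun (S : L2 α →L[ℂ] L2 α) (ξ : L2 γ) (b : β) :
    slice e b (amplFun e S ξ) = S (slice e b ξ) := by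
  ext a; simp [slice, amplFun]

theorem ext_slice {ξ η : L2 γ} (h : ∀ b, slice e b ξ = slice e b η) : ξ = η := by
  ext c
  have := congrArg (fun f : L2 α => f (e c).1) (h (e c).2)
  simpa [slice] using this

theorem slice_add (b : β) (ξ η : L2 γ) : slice e b (ξ + η) = slice e b ξ + slice e b η := rfl
theorem slice_smul (b : β) (z : ℂ) (ξ : L2 γ) : slice e b (z • ξ) = z • slice e b ξ := rfl

/-- The bounded operator `S ⊗ 1` on `ℓ²(γ) = ℓ²(α) ⊗ ℓ²(β)`. -/
def amplCLM (S : L2 α →L[ℂ] L2 α) : L2 γ →L[ℂ] L2 γ :=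
  LinearMap.mkContinuous
    { toFun := amplFun e S
      map_add' := fun ξ η => ext_slice e fun b => by simp [slice_amplFun, slice_add]
      map_smul' := fun z ξ => ext_slice e fun b => by simp [slice_amplFun, slice_smul] }
    ‖S‖ fun ξ => by
      refine le_of_sq_le_sq ?_ (by positivity) 
      have h1 := hasSum_norm_slice e (amplFun e S ξ)
      have h2 := (hasSum_norm_slice e ξ).mul_left (‖S‖ ^ 2)
      rw [mul_pow]
      refine hasSum_le (fun b => ?_) h1 h2
      rw [slice_amplFun, ← mul_pow]
      gcongr; exact S.le_opNorm _

theorem slice_amplCLM (S : L2 α →L[ℂ] L2 α) (ξ : L2 γ) (b : β) :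
    slice e b (amplCLM e S ξ) = S (slice e b ξ) := slice_amplFun e S ξ b

/-- The amplification `S ↦ S ⊗ 1`, `B(ℓ²(α)) → B(ℓ²(γ))`, for an identification `γ ≃ α × β`. -/
def ampl : (L2 α →L[ℂ] L2 α) →⋆ₐ[ℂ] (L2 γ →L[ℂ] L2 γ) where
  toFun := amplCLM e
  map_one' := by ext1 ξ; exact ext_slice e fun b => by simp [slice_amplCLM]
  map_mul' S T := by ext1 ξ; exact ext_slice e fun b => by simp [slice_amplCLM]
  map_zero' := by ext1 ξ; exact ext_slice e fun b => by rw [slice_amplCLM]; rfl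
  map_add' S T := by ext1 ξ; exact ext_slice e fun b => by simp [slice_amplCLM, slice_add]
  commutes' z := by
    ext1 ξ
    exact ext_slice e fun b => by
      simp [slice_amplCLM, slice_smul, Algebra.algebraMap_eq_smul_one]
  map_star' S := by
    rw [ContinuousLinearMap.star_eq_adjoint, ContinuousLinearMap.star_eq_adjoint,
      ContinuousLinearMap.eq_adjoint_iff]
    intro ξ η
    refine (hasSum_inner_slice e _ _).unique ?_
    simpa only [slice_amplCLM, ContinuousLinearMap.adjoint_inner_left] using
      hasSum_inner_slice e ξ (amplCLM e S η)

end Amplification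

/-- Configurations `ℤ → ℕ` that vanish at all but finitely many sites: `ℓ²(Config)` is the infinite
tensor product of copies of `ℓ²(ℕ)` along the unit vectors `e_0`. -/
abbrev Config : Type := ℤ →₀ ℕ

/-- A configuration is a pair of a configuration on `F` and one on the complement of `F`. -/
def splitConfig (F : Finset ℤ) : Config ≃ (F → ℕ) × ({i : ℤ // i ∉ F} →₀ ℕ) where
  toFun n := (fun i => n i, n.subtypeDomain (· ∉ F))
  invFun p := Finsupp.indicator F (fun i hi => p.1 ⟨i, hi⟩) + p.2.extendDomain
  left_inv n := by
    classical
    ext i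
    by_cases hi : i ∈ F <;> simp [Finsupp.extendDomain, hi]
  right_inv p := by
    classical
    ext i
    · simp [Finsupp.extendDomain]
    · simp [Finsupp.extendDomain, i.2]


/-- The algebra `B(ℓ²(ℕ)^{⊗F}) ⊗ 1` of operators localized in `F`. -/
def localOp (F : Finset ℤ) : StarSubalgebra ℂ (L2 Config →L[ℂ] L2 Config) :=
  (ampl (splitConfig F)).range

/-- The C*-algebra generated by all operators localized in bounded intervals. The maps
`B(ℓ²(ℕ)^{⊗I}) → B(ℓ²(Config))`, `S ↦ S ⊗ 1`, are injective *-homomorphisms compatible with the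
inclusions `B(ℓ²(ℕ)^{⊗I}) → B(ℓ²(ℕ)^{⊗J})`, `I ⊆ J`, so that this is the C*-algebraic colimit of the
local algebras. -/
def quasiLocal : StarSubalgebra ℂ (L2 Config →L[ℂ] L2 Config) :=
  (⨆ (p : ℤ) (q : ℤ), localOp (Finset.Icc p q)).topologicalClosure

/-- The quasi-local C*-algebra `L^∞ = colim_I B(ℓ²(ℕ)^{⊗I})`. -/
def LInf : Type := quasiLocal

instance : CStarAlgebra LInf :=
  haveI : IsClosed (quasiLocal : Set (L2 Config →L[ℂ] L2 Config)) :=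
    StarSubalgebra.isClosed_topologicalClosure _
  inferInstanceAs (CStarAlgebra quasiLocal)

instance : PartialOrder LInf := CStarAlgebra.spectralOrder LInf
instance : StarOrderedRing LInf := CStarAlgebra.spectralOrderedRing LInf

/-- The defining representation of `L^∞`. -/
def LInf.incl : LInf →⋆ₐ[ℂ] (L2 Config →L[ℂ] L2 Config) := quasiLocal.subtype

/-- The local algebra `L^∞_F ≅ B(ℓ²(ℕ)^{⊗F})` as a subalgebra of `L^∞`. -/
def LInf.loc (F : Finset ℤ) : StarSubalgebra ℂ LInf := (localOp F).comap LInf.incl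

section Corr

variable (A : Type) [CStarAlgebra A] [PartialOrder A] [StarOrderedRing A]

/-- An `A`-`A` correspondence: a right Hilbert C*-module over `A` (complete with respect to the norm
`‖x‖ = ‖⟨x, x⟩‖^{1/2}`), with a unital left action of `A` by adjointable operators.
`lact a x` is `a x` and `ract (op a) x` is `x a`; the inner product is linear in its second
variable. -/
structure Corr where
  carrier : Type
  [addCommGroup : AddCommGroup carrier]
  [module : Module ℂ carrier]
  lact : A →ₐ[ℂ] Module.End ℂ carrier
  ract : Aᵐᵒᵖ →ₐ[ℂ] Module.End ℂ carrier
  lact_ract : ∀ a b x, lact a (ract b x) = ract b (lact a x)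
  inner : carrier →ₗ⋆[ℂ] carrier →ₗ[ℂ] A
  inner_ract : ∀ x y a, inner x (ract (op a) y) = inner x y * a
  star_inner : ∀ x y, star (inner x y) = inner y x
  inner_self_nonneg : ∀ x, 0 ≤ inner x x
  inner_self_eq_zero : ∀ x, inner x x = 0 → x = 0
  inner_lact : ∀ a x y, inner (lact a x) y = inner x (lact (star a) y)
  complete : ∀ u : ℕ → carrier,
    (∀ ε > 0, ∃ N, ∀ m ≥ N, ∀ n ≥ N, √‖inner (u m - u n) (u m - u n)‖ < ε) →
    ∃ x, ∀ ε > 0, ∃ N, ∀ n ≥ N, √‖inner (u n - x) (u n - x)‖ < ε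

attribute [instance] Corr.addCommGroup Corr.module

variable {A}

/-- Finite projective bases: `x = ∑ i, b i ⟨b i, x⟩` for all `x`. -/
def IsProjBasis {V : Type} [AddCommGroup V] [Module ℂ V] (r : Aᵐᵒᵖ →ₐ[ℂ] Module.End ℂ V)
    (ip : V →ₗ⋆[ℂ] V →ₗ[ℂ] A) {n : ℕ} (b : Fin n → V) : Prop :=
  ∀ x, x = ∑ i, r (op (ip (b i) x)) (b i)

/-- Completeness is automatic if there is a finite projective basis. -/
theorem complete_of_basis {V : Type} [AddCommGroup V] [Module ℂ V]
    (r : Aᵐᵒᵖ →ₐ[ℂ] Module.End ℂ V) (ip : V →ₗ⋆[ℂ] V →ₗ[ℂ] A)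
    (hr : ∀ x y a, ip x (r (op a) y) = ip x y * a)
    (hs : ∀ x y, star (ip x y) = ip y x)
    {n : ℕ} {b : Fin n → V} (hb : IsProjBasis r ip b) (u : ℕ → V)
    (hu : ∀ ε > 0, ∃ N, ∀ m ≥ N, ∀ n ≥ N, √‖ip (u m - u n) (u m - u n)‖ < ε) :
    ∃ x, ∀ ε > 0, ∃ N, ∀ n ≥ N, √‖ip (u n - x) (u n - x)‖ < ε := by
  have key : ∀ x i, ‖ip (b i) x‖ ≤ √‖ip x x‖ := by
    intro x i
    have h1 : ip x x = ∑ j, star (ip (b j) x) * ip (b j) x := by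
      conv_lhs => rw [hb x, map_sum]
      rw [← hb x]
      exact Finset.sum_congr rfl fun j _ => by rw [hr, hs]
    have h2 : star (ip (b i) x) * ip (b i) x ≤ ip x x := by
      rw [h1]
      exact Finset.single_le_sum (f := fun j => star (ip (b j) x) * ip (b j) x)
        (fun j _ => star_mul_self_nonneg _) (Finset.mem_univ i)
    have h3 := CStarAlgebra.norm_le_norm_of_nonneg_of_le (star_mul_self_nonneg _) h2
    rw [CStarRing.norm_star_mul_self] at h3
    exact Real.le_sqrt_of_sq_le (by rw [sq]; exact h3)
  have hc : ∀ i, ∃ a, Filter.Tendsto (fun k => ip (b i) (u k)) Filter.atTop (nhds a) := by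
    intro i
    refine cauchySeq_tendsto_of_complete (Metric.cauchySeq_iff.2 fun ε hε => ?_)
    obtain ⟨N, hN⟩ := hu ε hε
    refine ⟨N, fun m hm k hk => ?_⟩
    rw [dist_eq_norm, ← map_sub]
    exact (key _ i).trans_lt (hN m hm k hk)
  choose a ha using hc
  refine ⟨∑ i, r (op (a i)) (b i), ?_⟩
  have hform : ∀ k, ip (u k - ∑ i, r (op (a i)) (b i)) (u k - ∑ i, r (op (a i)) (b i)) =
      ∑ i, ∑ j, star (ip (b j) (u k) - a j) * ip (b j) (b i) * (ip (b i) (u k) - a i) := by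
    intro k
    have : u k - ∑ i, r (op (a i)) (b i) = ∑ i, r (op (ip (b i) (u k) - a i)) (b i) := by
      conv_lhs => rw [hb (u k)]
      rw [← Finset.sum_sub_distrib]
      exact Finset.sum_congr rfl fun i _ => by rw [MulOpposite.op_sub, map_sub, LinearMap.sub_apply]
    rw [this, map_sum]
    refine Finset.sum_congr rfl fun i _ => ?_
    rw [hr, ← hs, map_sum, star_sum, Finset.sum_mul]
    exact Finset.sum_congr rfl fun j _ => by rw [hr, star_mul, hs]
  have hlim : Filter.Tendsto (fun k => √‖ip (u k - ∑ i, r (op (a i)) (b i))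
      (u k - ∑ i, r (op (a i)) (b i))‖) Filter.atTop (nhds 0) := by
    simp_rw [hform]
    have h0 : ∀ i, Filter.Tendsto (fun k => ip (b i) (u k) - a i) Filter.atTop (nhds 0) :=
      fun i => by simpa using (ha i).sub_const (a i)
    have : Filter.Tendsto (fun k => ∑ i, ∑ j, star (ip (b j) (u k) - a j) * ip (b j) (b i) *
        (ip (b i) (u k) - a i)) Filter.atTop (nhds (∑ i : Fin n, ∑ j : Fin n,
          star 0 * ip (b j) (b i) * 0)) :=
      tendsto_finsetSum _ fun i _ => tendsto_finsetSum _ fun j _ =>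
        (((h0 j).star).mul_const _).mul (h0 i)
    simpa using (this.norm).sqrt
  intro ε hε
  obtain ⟨N, hN⟩ := Metric.tendsto_atTop.1 hlim ε hε
  exact ⟨N, fun k hk => by
    have := hN k hk
    rw [Real.dist_0_eq_abs] at this
    exact (le_abs_self _).trans_lt this⟩

variable (A) in
/-- Correspondences that have a finite projective basis. -/
structure FGCorr extends Corr A where
  exists_basis : ∃ (n : ℕ) (b : Fin n → carrier), IsProjBasis ract inner b

namespace FGCorr

instance : CoeSort (FGCorr A) Type := ⟨fun X => X.carrier⟩

variable (X Y Z W : FGCorr A)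

/-- Morphisms of correspondences: adjointable bimodule maps. -/
def homSubmodule : Submodule ℂ (X →ₗ[ℂ] Y) where
  carrier := {f | (∀ a x, f (X.lact a x) = Y.lact a (f x)) ∧
    (∀ a x, f (X.ract a x) = Y.ract a (f x)) ∧
    ∃ g : Y → X, ∀ x y, Y.inner (f x) y = X.inner x (g y)}
  zero_mem' := ⟨by simp, by simp, fun _ => 0, by simp⟩
  add_mem' := by
    rintro f f' ⟨h1, h2, g, h3⟩ ⟨h1', h2', g', h3'⟩
    exact ⟨by simp [h1, h1'], by simp [h2, h2'], fun y => g y + g' y, by simp [h3, h3']⟩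
  smul_mem' := by
    rintro z f ⟨h1, h2, g, h3⟩
    exact ⟨by simp [h1], by simp [h2], fun y => star z • g y, by simp [h3]⟩

variable {X Y Z W}

/-- Right linear maps are adjointable if there is a finite projective basis. -/
theorem adjointable (f : X →ₗ[ℂ] Y) (hr : ∀ a x, f (X.ract a x) = Y.ract a (f x)) :
    ∃ g : Y → X, ∀ x y, Y.inner (f x) y = X.inner x (g y) := by
  obtain ⟨n, b, hb⟩ := X.exists_basis
  refine ⟨fun y => ∑ i, X.ract (op (Y.inner (f (b i)) y)) (b i), fun x y => ?_⟩
  conv_lhs => rw [hb x]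
  simp only [map_sum, LinearMap.sum_apply, X.inner_ract, hr]
  refine Finset.sum_congr rfl fun i _ => ?_
  rw [← Y.star_inner, Y.inner_ract, star_mul, X.star_inner, Y.star_inner]

instance : Category (FGCorr A) where
  Hom X Y := ↥(homSubmodule X Y)
  id X := ⟨LinearMap.id, fun _ _ => rfl, fun _ _ => rfl, id, fun _ _ => rfl⟩
  comp {X Y Z} f g := ⟨g.1 ∘ₗ f.1, fun a x => by simp [f.2.1, g.2.1],
    fun a x => by simp [f.2.2.1, g.2.2.1], by
      obtain ⟨f', hf⟩ := f.2.2.2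
      obtain ⟨g', hg⟩ := g.2.2.2
      exact ⟨fun z => f' (g' z), fun x z => by simp [hf, hg]⟩⟩

/-- A morphism from a bimodule map. -/
def mkHom (f : X →ₗ[ℂ] Y) (hl : ∀ a x, f (X.lact a x) = Y.lact a (f x))
    (hr : ∀ a x, f (X.ract a x) = Y.ract a (f x)) : X ⟶ Y :=
  ⟨f, hl, hr, adjointable f hr⟩

/-- The linear map underlying a morphism. -/
def Hom.lin (f : X ⟶ Y) : X →ₗ[ℂ] Y := f.1

theorem hom_ext {f g : X ⟶ Y} (h : ∀ x, Hom.lin f x = Hom.lin g x) : f = g :=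
  Subtype.ext (LinearMap.ext h)

theorem lin_lact (f : X ⟶ Y) (a : A) (x : X) :
  Hom.lin f (X.lact a x) = Y.lact a (Hom.lin f x) := f.2.1 a x
theorem lin_ract (f : X ⟶ Y) (a : Aᵐᵒᵖ) (x : X) :
  Hom.lin f (X.ract a x) = Y.ract a (Hom.lin f x) := f.2.2.1 a x
@[simp] theorem lin_id (x : X) : Hom.lin (𝟙 X) x = x := rfl
@[simp] theorem lin_comp (f : X ⟶ Y) (g : Y ⟶ Z) (x : X) :
  Hom.lin (f ≫ g) x = Hom.lin g (Hom.lin f x) := rfl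
@[simp] theorem lin_mkHom (f : X →ₗ[ℂ] Y) (hl hr) (x : X) :
  Hom.lin (mkHom f hl hr) x = f x := rfl

instance (X Y : FGCorr A) : AddCommGroup (X ⟶ Y) := inferInstanceAs (AddCommGroup ↥(homSubmodule X Y))
instance (X Y : FGCorr A) : Module ℂ (X ⟶ Y) := inferInstanceAs (Module ℂ ↥(homSubmodule X Y))

theorem lin_add (f g : X ⟶ Y) (x : X) : Hom.lin (f + g) x = Hom.lin f x + Hom.lin g x := rfl
theorem lin_smul (z : ℂ) (f : X ⟶ Y) (x : X) : Hom.lin (z • f) x = z • Hom.lin f x := rfl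

instance : Preadditive (FGCorr A) where
  add_comp _ _ _ f f' g := hom_ext fun x => by simp [lin_add]
  comp_add _ _ _ f f' g := hom_ext fun x => by simp [lin_add]

instance : Linear ℂ (FGCorr A) where
  smul_comp _ _ _ z f g := hom_ext fun x => by simp [lin_smul]
  comp_smul _ _ _ f z g := hom_ext fun x => by simp [lin_smul]

theorem ext_inner {x x' : X} (h : ∀ y, X.inner y x = X.inner y x') : x = x' := by
  rw [← sub_eq_zero]
  apply X.inner_self_eq_zero
  rw [map_sub, h, sub_self]

/-- The adjoint of a morphism. -/
def dag (f : X ⟶ Y) : Y ⟶ X :=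
  have hg := f.2.2.2.choose_spec
  mkHom
    { toFun := f.2.2.2.choose
      map_add' := fun y y' => ext_inner fun x => by rw [map_add, ← hg, ← hg, ← hg, map_add]
      map_smul' := fun z y => ext_inner fun x => by
        rw [RingHom.id_apply, map_smul, ← hg, ← hg, map_smul] }
    (fun a y => ext_inner fun x => by
      have := X.inner_lact (star a) x (f.2.2.2.choose y)
      rw [star_star] at this
      change X.inner x (f.2.2.2.choose (Y.lact a y)) = X.inner x (X.lact a (f.2.2.2.choose y))
      rw [← this, ← hg, ← hg, f.2.1, Y.inner_lact, star_star])
    (fun a y => ext_inner fun x => by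
      obtain ⟨a, rfl⟩ := MulOpposite.op_surjective a
      change X.inner x (f.2.2.2.choose (Y.ract (op a) y)) =
        X.inner x (X.ract (op a) (f.2.2.2.choose y))
      rw [X.inner_ract, ← hg, ← hg, Y.inner_ract])

theorem inner_dag (f : X ⟶ Y) (x : X) (y : Y) :
    Y.inner (Hom.lin f x) y = X.inner x (Hom.lin (dag f) y) :=
  f.2.2.2.choose_spec x y


section Tensor

variable (X Y : FGCorr A)

/-- The relations `x a ⊗ y = x ⊗ a y`. -/
def balRel : Submodule ℂ (X ⊗[ℂ] Y) :=
  Submodule.span ℂ {t | ∃ (x : X) (a : A) (y : Y),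
    t = X.ract (op a) x ⊗ₜ[ℂ] y - x ⊗ₜ[ℂ] Y.lact a y}

/-- The relative tensor product `X ⊗_A Y`. For correspondences with finite projective bases it is
already separated and complete for the inner product
`⟨x ⊗ y, x' ⊗ y'⟩ = ⟨y, ⟨x, x'⟩ y'⟩` (see `Bal.inner_tmul` and `tensor`), hence it is the tensor
product of correspondences. -/
abbrev Bal : Type := (X ⊗[ℂ] Y) ⧸ balRel X Y

variable {X Y}

/-- Simple tensors. -/
def tmul (x : X) (y : Y) : Bal X Y := (balRel X Y).mkQ (x ⊗ₜ[ℂ] y)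

theorem ract_tmul (x : X) (a : A) (y : Y) : tmul (X.ract (op a) x) y = tmul x (Y.lact a y) := by
  rw [← sub_eq_zero, tmul, tmul, ← map_sub, Submodule.mkQ_apply, Submodule.Quotient.mk_eq_zero]
  exact Submodule.subset_span ⟨x, a, y, rfl⟩

theorem add_tmul (x x' : X) (y : Y) : tmul (x + x') y = tmul x y + tmul x' y := by
  simp only [tmul, TensorProduct.add_tmul, map_add]
theorem tmul_add (x : X) (y y' : Y) : tmul x (y + y') = tmul x y + tmul x y' := by
  simp only [tmul, TensorProduct.tmul_add, map_add]
theorem smul_tmul (z : ℂ) (x : X) (y : Y) : tmul (z • x) y = z • tmul x y := by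
  rw [tmul, tmul, ← TensorProduct.smul_tmul', map_smul]
theorem tmul_smul (z : ℂ) (x : X) (y : Y) : tmul x (z • y) = z • tmul x y := by
  simp only [tmul, TensorProduct.tmul_smul, map_smul]

variable (X Y) in
/-- The bilinear map `(x, y) ↦ x ⊗ y`. -/
def tmulₗ : X →ₗ[ℂ] Y →ₗ[ℂ] Bal X Y :=
  LinearMap.mk₂ ℂ tmul add_tmul smul_tmul tmul_add tmul_smul

theorem sum_tmul {n : ℕ} (x : Fin n → X) (y : Y) :
    tmul (∑ i, x i) y = ∑ i, tmul (x i) y :=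
  LinearMap.map_sum₂ (tmulₗ X Y) Finset.univ x y
theorem tmul_sum {n : ℕ} (x : X) (y : Fin n → Y) :
    tmul x (∑ i, y i) = ∑ i, tmul x (y i) :=
  map_sum (tmulₗ X Y x) y Finset.univ

@[elab_as_elim]
theorem Bal.induction {p : Bal X Y → Prop} (t : Bal X Y) (h1 : ∀ x y, p (tmul x y))
    (h2 : ∀ t t', p t → p t' → p (t + t')) : p t := by
  obtain ⟨t, rfl⟩ := (balRel X Y).mkQ_surjective t
  induction t with
  | zero => simpa [tmul] using h1 0 0
  | tmul x y => exact h1 x y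
  | add t t' ht ht' => rw [map_add]; exact h2 _ _ ht ht'

/-- The linear map induced by a balanced bilinear map. -/
def Bal.lift {V : Type} [AddCommGroup V] [Module ℂ V] (f : X →ₗ[ℂ] Y →ₗ[ℂ] V)
    (hf : ∀ x a y, f (X.ract (op a) x) y = f x (Y.lact a y)) : Bal X Y →ₗ[ℂ] V :=
  (balRel X Y).liftQ (TensorProduct.lift f) <| by
    refine Submodule.span_le.2 ?_
    rintro _ ⟨x, a, y, rfl⟩
    simp [hf]

@[simp] theorem Bal.lift_tmul {V : Type} [AddCommGroup V] [Module ℂ V] (f : X →ₗ[ℂ] Y →ₗ[ℂ] V)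
    (hf : ∀ x a y, f (X.ract (op a) x) y = f x (Y.lact a y)) (x : X) (y : Y) :
    Bal.lift f hf (tmul x y) = f x y := rfl

theorem Bal.lin_ext {V : Type} [AddCommGroup V] [Module ℂ V] {f g : Bal X Y →ₗ[ℂ] V}
    (h : ∀ x y, f (tmul x y) = g (tmul x y)) (t : Bal X Y) : f t = g t := by
  induction t using Bal.induction with
  | h1 x y => exact h x y
  | h2 t t' ht ht' => rw [map_add, map_add, ht, ht']

/-- The map `f ⊗ g`. -/
def Bal.map {X' Y' : FGCorr A} (f : X →ₗ[ℂ] X') (g : Y →ₗ[ℂ] Y')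
    (hf : ∀ a x, f (X.ract a x) = X'.ract a (f x))
    (hg : ∀ a y, g (Y.lact a y) = Y'.lact a (g y)) : Bal X Y →ₗ[ℂ] Bal X' Y' :=
  Bal.lift ((tmulₗ X' Y').compl₁₂ f g) fun x a y => by
    change tmul (f _) (g y) = tmul (f x) (g _)
    rw [hf, hg, ract_tmul]

@[simp] theorem Bal.map_tmul {X' Y' : FGCorr A} (f : X →ₗ[ℂ] X') (g : Y →ₗ[ℂ] Y') (hf hg)
    (x : X) (y : Y) : Bal.map f g hf hg (tmul x y) = tmul (f x) (g y) := rfl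

variable (X Y) in
/-- `a (x ⊗ y) = a x ⊗ y`. -/
def Bal.lact : A →ₐ[ℂ] Module.End ℂ (Bal X Y) where
  toFun a := Bal.map (X.lact a) LinearMap.id (fun b x => X.lact_ract a b x) (fun _ _ => rfl)
  map_one' := LinearMap.ext <| Bal.lin_ext fun x y => by simp
  map_mul' a b := LinearMap.ext <| Bal.lin_ext fun x y => by simp
  map_zero' := LinearMap.ext <| Bal.lin_ext fun x y => by
    simpa using smul_tmul 0 (0 : X) y
  map_add' a b := LinearMap.ext <| Bal.lin_ext fun x y => by simp [add_tmul]
  commutes' z := LinearMap.ext <| Bal.lin_ext fun x y => by simp [smul_tmul]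

variable (X Y) in
/-- `(x ⊗ y) a = x ⊗ y a`. -/
def Bal.ract : Aᵐᵒᵖ →ₐ[ℂ] Module.End ℂ (Bal X Y) where
  toFun a := Bal.map LinearMap.id (Y.ract a) (fun _ _ => rfl) (fun b y => (Y.lact_ract b a y).symm)
  map_one' := LinearMap.ext <| Bal.lin_ext fun x y => by simp
  map_mul' a b := LinearMap.ext <| Bal.lin_ext fun x y => by simp
  map_zero' := LinearMap.ext <| Bal.lin_ext fun x y => by
    simpa using tmul_smul 0 x (0 : Y)
  map_add' a b := LinearMap.ext <| Bal.lin_ext fun x y => by simp [tmul_add]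
  commutes' z := LinearMap.ext <| Bal.lin_ext fun x y => by
    rw [Bal.map_tmul, AlgHom.commutes]
    simp [tmul_smul]

@[simp] theorem Bal.lact_tmul (a : A) (x : X) (y : Y) :
    Bal.lact X Y a (tmul x y) = tmul (X.lact a x) y := rfl
@[simp] theorem Bal.ract_tmul (a : Aᵐᵒᵖ) (x : X) (y : Y) :
    Bal.ract X Y a (tmul x y) = tmul x (Y.ract a y) := rfl

/-- The map `x ⊗ y ↦ ⟨b, x⟩ y`. -/
def Bal.contract (b : X) : Bal X Y →ₗ[ℂ] Y :=
  Bal.lift (Y.lact.toLinearMap ∘ₗ X.inner b) fun x a y => by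
    simp [X.inner_ract]

@[simp] theorem Bal.contract_tmul (b x : X) (y : Y) :
    Bal.contract b (tmul x y) = Y.lact (X.inner b x) y := rfl

variable (X Y) in
/-- The inner product, written with a projective basis of `X`; it does not depend on the basis, by
`Bal.inner_tmul`. -/
def Bal.inner : Bal X Y →ₗ⋆[ℂ] Bal X Y →ₗ[ℂ] A :=
  ∑ i, (Y.inner.comp (Bal.contract (X.exists_basis.choose_spec.choose i))).compl₂
    (Bal.contract (X.exists_basis.choose_spec.choose i))

theorem Bal.inner_apply (s t : Bal X Y) : Bal.inner X Y s t =
    ∑ i, Y.inner (Bal.contract (X.exists_basis.choose_spec.choose i) s)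
      (Bal.contract (X.exists_basis.choose_spec.choose i) t) := by
  simp [Bal.inner]

theorem Bal.inner_tmul (x x' : X) (y y' : Y) :
    Bal.inner X Y (tmul x y) (tmul x' y') = Y.inner y (Y.lact (X.inner x x') y') := by
  rw [Bal.inner_apply]
  conv_rhs => rw [X.exists_basis.choose_spec.choose_spec x']
  simp only [map_sum, LinearMap.sum_apply, X.inner_ract, Bal.contract_tmul, Y.inner_lact,
    X.star_inner, map_mul, Module.End.mul_apply]

theorem Bal.basis {n m : ℕ} {b : Fin n → X} {c : Fin m → Y} (hb : IsProjBasis X.ract X.inner b)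
    (hc : IsProjBasis Y.ract Y.inner c) :
    IsProjBasis (Bal.ract X Y) (Bal.inner X Y)
      (fun k => tmul (b (finProdFinEquiv.symm k).1) (c (finProdFinEquiv.symm k).2)) := by
  intro t
  induction t using Bal.induction with
  | h1 x y =>
    simp only [Bal.inner_tmul, Bal.ract_tmul]
    rw [finProdFinEquiv.symm.sum_comp
      (fun p : Fin n × Fin m =>
        tmul (b p.1) (Y.ract (op (Y.inner (c p.2) (Y.lact (X.inner (b p.1) x) y))) (c p.2))),
      Fintype.sum_prod_type]
    simp only [← tmul_sum, ← hc _]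
    simp only [← FGCorr.ract_tmul, ← sum_tmul, ← hb _]
  | h2 t t' ht ht' =>
    simp only [map_add, MulOpposite.op_add, LinearMap.add_apply, Finset.sum_add_distrib]
    rw [← ht, ← ht']

theorem Bal.star_inner (s t : Bal X Y) : star (Bal.inner X Y s t) = Bal.inner X Y t s := by
  simp only [Bal.inner_apply, star_sum, Y.star_inner]

theorem Bal.inner_ract (s t : Bal X Y) (a : A) :
    Bal.inner X Y s (Bal.ract X Y (op a) t) = Bal.inner X Y s t * a := by
  induction t using Bal.induction with
  | h1 x y =>
    induction s using Bal.induction with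
    | h1 x' y' => simp only [Bal.ract_tmul, Bal.inner_tmul, Y.lact_ract, Y.inner_ract]
    | h2 s s' h h' => simp only [map_add, LinearMap.add_apply, add_mul, h, h']
  | h2 t t' h h' => simp only [map_add, add_mul, h, h']

variable (X Y) in
/-- The tensor product `X ⊠_A Y` of correspondences. -/
def tensor : FGCorr A where
  carrier := Bal X Y
  lact := Bal.lact X Y
  ract := Bal.ract X Y
  lact_ract a b t := by
    induction t using Bal.induction with
    | h1 x y => rfl
    | h2 t t' h h' => simp only [map_add, h, h']
  inner := Bal.inner X Y
  inner_ract := Bal.inner_ract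
  star_inner := Bal.star_inner
  inner_self_nonneg t := by
    rw [Bal.inner_apply]
    exact Finset.sum_nonneg fun i _ => Y.inner_self_nonneg _
  inner_self_eq_zero t ht := by
    rw [Bal.inner_apply, Finset.sum_eq_zero_iff_of_nonneg fun i _ => Y.inner_self_nonneg _] at ht
    have key : ∀ s : Bal X Y, s = ∑ i, tmul (X.exists_basis.choose_spec.choose i)
        (Bal.contract (X.exists_basis.choose_spec.choose i) s) := by
      intro s
      induction s using Bal.induction with
      | h1 x y =>
        simp only [Bal.contract_tmul, ← FGCorr.ract_tmul, ← sum_tmul]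
        rw [← X.exists_basis.choose_spec.choose_spec x]
      | h2 s s' h h' =>
        simp only [map_add, tmul_add, Finset.sum_add_distrib]
        rw [← h, ← h']
    rw [key t]
    refine Finset.sum_eq_zero fun i hi => ?_
    rw [Y.inner_self_eq_zero _ (ht i hi)]
    exact map_zero (tmulₗ X Y _)
  inner_lact a s t := by
    induction t using Bal.induction with
    | h1 x y =>
      induction s using Bal.induction with
      | h1 x' y' => simp only [Bal.lact_tmul, Bal.inner_tmul, X.inner_lact]
      | h2 s s' h h' => simp only [map_add, LinearMap.add_apply, h, h']
    | h2 t t' h h' => simp only [map_add, h, h']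
  complete := complete_of_basis _ _ Bal.inner_ract Bal.star_inner
    (Bal.basis X.exists_basis.choose_spec.choose_spec Y.exists_basis.choose_spec.choose_spec)
  exists_basis := ⟨_, _,
    Bal.basis X.exists_basis.choose_spec.choose_spec Y.exists_basis.choose_spec.choose_spec⟩

end Tensor

section Free

/-- The inner product `⟨x, y⟩ = ∑ i, (x i)* (y i)` on `A^{⊕k}`. -/
def freeInner (k : ℕ) : (Fin k → A) →ₗ⋆[ℂ] (Fin k → A) →ₗ[ℂ] A :=
  LinearMap.mk₂'ₛₗ (starRingEnd ℂ) (RingHom.id ℂ) (fun x y => ∑ i, star (x i) * y i)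
    (fun x x' y => by simp [add_mul, Finset.sum_add_distrib])
    (fun z x y => by simp [Finset.smul_sum])
    (fun x y y' => by simp [mul_add, Finset.sum_add_distrib])
    (fun z x y => by simp [Finset.smul_sum])

theorem freeInner_apply {k : ℕ} (x y : Fin k → A) : freeInner k x y = ∑ i, star (x i) * y i := rfl

theorem freeInner_ract {k : ℕ} (x y : Fin k → A) (a : A) :
    freeInner k x (Algebra.lsmul ℂ ℂ (Fin k → A) (op a) y) = freeInner k x y * a := by
  simp [freeInner_apply, Finset.sum_mul, mul_assoc]

theorem star_freeInner {k : ℕ} (x y : Fin k → A) :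
    star (freeInner k x y) = freeInner k y x := by
  simp [freeInner_apply]

theorem free_basis (k : ℕ) : IsProjBasis (A := A) (Algebra.lsmul ℂ ℂ (Fin k → A)) (freeInner k)
    (fun i : Fin k => Pi.single i (1 : A)) := fun x => by
  ext j
  simp [freeInner_apply, Pi.single_apply, apply_ite star]

variable (A) in
/-- The direct sum `A^{⊕k}` of `k` copies of the trivial correspondence. -/
def free (k : ℕ) : FGCorr A where
  carrier := Fin k → A
  lact := Algebra.lsmul ℂ ℂ (Fin k → A)
  ract := Algebra.lsmul ℂ ℂ (Fin k → A)
  lact_ract a b x := smul_comm a b x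
  inner := freeInner k
  inner_ract := freeInner_ract
  star_inner := star_freeInner
  inner_self_nonneg x := by
    rw [freeInner_apply]
    exact Finset.sum_nonneg fun i _ => star_mul_self_nonneg (x i)
  inner_self_eq_zero x hx := by
    rw [freeInner_apply, Finset.sum_eq_zero_iff_of_nonneg
      fun i _ => star_mul_self_nonneg (x i)] at hx
    funext i
    exact CStarRing.star_mul_self_eq_zero_iff _ |>.1 (hx i (Finset.mem_univ i))
  inner_lact a x y := by simp [freeInner_apply, mul_assoc]
  complete := complete_of_basis _ _ freeInner_ract star_freeInner (free_basis k)
  exists_basis := ⟨k, _, free_basis k⟩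

/-- The inner product `⟨x, y⟩ = x* y` on `A`. -/
def unitInner : A →ₗ⋆[ℂ] A →ₗ[ℂ] A :=
  LinearMap.mk₂'ₛₗ (starRingEnd ℂ) (RingHom.id ℂ) (fun x y => star x * y)
    (fun x x' y => by simp [add_mul]) (fun z x y => by simp)
    (fun x y y' => by simp [mul_add]) (fun z x y => by simp)

theorem unitInner_apply (x y : A) : unitInner x y = star x * y := rfl

theorem unitInner_ract (x y a : A) :
    unitInner x (Algebra.lsmul ℂ ℂ A (op a) y) = unitInner x y * a := by
  simp [unitInner_apply, mul_assoc]

theorem star_unitInner (x y : A) : star (unitInner x y) = unitInner y x := by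
  simp [unitInner_apply]

theorem unit_basis : IsProjBasis (A := A) (Algebra.lsmul ℂ ℂ A) unitInner
    (fun _ : Fin 1 => (1 : A)) := fun x => by
  simp [unitInner_apply]

variable (A) in
/-- The trivial correspondence `A`. -/
def unit : FGCorr A where
  carrier := A
  lact := Algebra.lsmul ℂ ℂ A
  ract := Algebra.lsmul ℂ ℂ A
  lact_ract a b x := smul_comm a b x
  inner := unitInner
  inner_ract := unitInner_ract
  star_inner := star_unitInner
  inner_self_nonneg x := star_mul_self_nonneg x
  inner_self_eq_zero x hx := CStarRing.star_mul_self_eq_zero_iff _ |>.1 hx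
  inner_lact a x y := by simp [unitInner_apply, mul_assoc]
  complete := complete_of_basis _ _ unitInner_ract star_unitInner unit_basis
  exists_basis := ⟨1, _, unit_basis⟩

end Free

section Monoidal

variable {X Y Z W V : FGCorr A}

/-- The simple tensor `x ⊗ y` in `X ⊠ Y`. -/
def tens (x : X) (y : Y) : tensor X Y := tmul x y

theorem ract_tens (x : X) (a : A) (y : Y) :
    tens (X.ract (op a) x) y = tens x (Y.lact a y) := ract_tmul x a y
theorem add_tens (x x' : X) (y : Y) : tens (x + x') y = tens x y + tens x' y := add_tmul x x' y
theorem tens_add (x : X) (y y' : Y) : tens x (y + y') = tens x y + tens x y' := tmul_add x y y'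
theorem smul_tens (z : ℂ) (x : X) (y : Y) : tens (z • x) y = z • tens x y := smul_tmul z x y
theorem tens_smul (z : ℂ) (x : X) (y : Y) : tens x (z • y) = z • tens x y := tmul_smul z x y
theorem lact_tens (a : A) (x : X) (y : Y) :
    (tensor X Y).lact a (tens x y) = tens (X.lact a x) y := rfl
theorem ract_tens' (a : Aᵐᵒᵖ) (x : X) (y : Y) :
    (tensor X Y).ract a (tens x y) = tens x (Y.ract a y) := rfl
theorem inner_tens (x x' : X) (y y' : Y) :
    (tensor X Y).inner (tens x y) (tens x' y') = Y.inner y (Y.lact (X.inner x x') y') :=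
  Bal.inner_tmul x x' y y'

theorem tens_induction {p : tensor X Y → Prop} (h1 : ∀ x y, p (tens x y))
    (h2 : ∀ t t', p t → p t' → p (t + t')) (t : tensor X Y) : p t :=
  Bal.induction (p := p) t h1 h2

/-- The linear map on `X ⊠ Y` induced by a balanced bilinear map. -/
def tensLift {U : Type} [AddCommGroup U] [Module ℂ U] (f : X → Y → U)
    (h1 : ∀ x x' y, f (x + x') y = f x y + f x' y) (h2 : ∀ (z : ℂ) x y, f (z • x) y = z • f x y)
    (h3 : ∀ x y y', f x (y + y') = f x y + f x y') (h4 : ∀ (z : ℂ) x y, f x (z • y) = z • f x y)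
    (hf : ∀ x a y, f (X.ract (op a) x) y = f x (Y.lact a y)) : tensor X Y →ₗ[ℂ] U :=
  Bal.lift (LinearMap.mk₂ ℂ f h1 h2 h3 h4) hf

@[simp] theorem tensLift_tens {U : Type} [AddCommGroup U] [Module ℂ U] (f : X → Y → U)
    (h1 h2 h3 h4 hf) (x : X) (y : Y) :
    tensLift (U := U) f h1 h2 h3 h4 hf (tens x y) = f x y := rfl

theorem tensor_hom_ext {f g : tensor X Y ⟶ Z}
    (h : ∀ (x : X) (y : Y), Hom.lin f (tens x y) = Hom.lin g (tens x y)) : f = g :=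
  hom_ext (Bal.lin_ext h)

theorem tensor_hom_ext₃ {f g : tensor (tensor X Y) Z ⟶ W}
    (h : ∀ (x : X) (y : Y) (z : Z),
      Hom.lin f (tens (tens x y) z) = Hom.lin g (tens (tens x y) z)) : f = g :=
  tensor_hom_ext fun t z => by
    induction t using tens_induction with
    | h1 x y => exact h x y z
    | h2 t t' h h' => simp only [map_add, add_tens, h, h']

theorem tensor_hom_ext₄ {f g : tensor (tensor (tensor X Y) Z) V ⟶ W}
    (h : ∀ (x : X) (y : Y) (z : Z) (v : V), Hom.lin f (tens (tens (tens x y) z) v) =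
      Hom.lin g (tens (tens (tens x y) z) v)) : f = g :=
  tensor_hom_ext₃ fun t z v => by
    induction t using tens_induction with
    | h1 x y => exact h x y z v
    | h2 t t' h h' => simp only [map_add, add_tens, h, h']

/-- A morphism out of a tensor product, from a linear map that respects the actions on simple
tensors. -/
def tensorHomMk (f : tensor X Y →ₗ[ℂ] Z)
    (hl : ∀ a x y, f (tens (X.lact a x) y) = Z.lact a (f (tens x y)))
    (hr : ∀ a x y, f (tens x (Y.ract a y)) = Z.ract a (f (tens x y))) : tensor X Y ⟶ Z :=
  mkHom f
    (fun a t => by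
      induction t using tens_induction with
      | h1 x y => exact hl a x y
      | h2 t t' h h' => simp only [map_add, h, h'])
    (fun a t => by
      induction t using tens_induction with
      | h1 x y => exact hr a x y
      | h2 t t' h h' => simp only [map_add, h, h'])

/-- The tensor product of morphisms. -/
def tensorMap {X' Y' : FGCorr A} (f : X ⟶ X') (g : Y ⟶ Y') : tensor X Y ⟶ tensor X' Y' :=
  tensorHomMk
    (tensLift (fun x y => tens (Hom.lin f x) (Hom.lin g y))
      (by simp [add_tens]) (by simp [smul_tens]) (by simp [tens_add]) (by simp [tens_smul])
      (by simp [lin_ract, lin_lact, ract_tens]))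
    (by simp [lact_tens, lin_lact]) (by simp [ract_tens', lin_ract])

@[simp] theorem tensorMap_tens {X' Y' : FGCorr A} (f : X ⟶ X') (g : Y ⟶ Y') (x : X) (y : Y) :
    Hom.lin (tensorMap f g) (tens x y) = tens (Hom.lin f x) (Hom.lin g y) := rfl

/-- `x ⊗ y ↦ x ⊗ (y ⊗ z)`. -/
def assocHomAux (X Y : FGCorr A) {Z : FGCorr A} (z : Z) :
    tensor X Y →ₗ[ℂ] tensor X (tensor Y Z) :=
  tensLift (fun x y => tens x (tens y z))
    (by simp [add_tens]) (by simp [smul_tens]) (by simp [add_tens, tens_add])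
    (by simp [smul_tens, tens_smul]) (by simp [ract_tens, lact_tens])

/-- `y ⊗ z ↦ (x ⊗ y) ⊗ z`. -/
def assocInvAux {X : FGCorr A} (x : X) (Y Z : FGCorr A) :
    tensor Y Z →ₗ[ℂ] tensor (tensor X Y) Z :=
  tensLift (fun y z => tens (tens x y) z)
    (by simp [add_tens, tens_add]) (by simp [smul_tens, tens_smul]) (by simp [tens_add])
    (by simp [tens_smul]) (by simp [← ract_tens, ract_tens'])

/-- The associator `(x ⊗ y) ⊗ z ↦ x ⊗ (y ⊗ z)`. -/
def assoc (X Y Z : FGCorr A) : tensor (tensor X Y) Z ≅ tensor X (tensor Y Z) where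
  hom := tensorHomMk
    (tensLift (fun t z => assocHomAux X Y z t) (by simp) (by simp)
      (fun t z z' => by
        induction t using tens_induction with
        | h1 x y => simp [assocHomAux, tens_add]
        | h2 t t' h h' => simp only [map_add, h, h']; abel)
      (fun c t z => by
        induction t using tens_induction with
        | h1 x y => simp [assocHomAux, tens_smul]
        | h2 t t' h h' => simp only [map_add, h, h', smul_add])
      (fun t a z => by
        induction t using tens_induction with
        | h1 x y => simp [assocHomAux, ract_tens', ract_tens]
        | h2 t t' h h' => simp only [map_add, h, h']))
    (fun a t z => by
      induction t using tens_induction with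
      | h1 x y => rfl
      | h2 t t' h h' => simp only [map_add, add_tens, h, h'])
    (fun a t z => by
      induction t using tens_induction with
      | h1 x y => rfl
      | h2 t t' h h' => simp only [map_add, add_tens, h, h'])
  inv := tensorHomMk
    (tensLift (fun x t => assocInvAux x Y Z t)
      (fun x x' t => by
        induction t using tens_induction with
        | h1 x y => simp [assocInvAux, add_tens]
        | h2 t t' h h' => simp only [map_add, h, h']; abel)
      (fun c x t => by
        induction t using tens_induction with
        | h1 x y => simp [assocInvAux, smul_tens]
        | h2 t t' h h' => simp only [map_add, h, h', smul_add])
      (by simp) (by simp)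
      (fun x a t => by
        induction t using tens_induction with
        | h1 x y => simp [assocInvAux, lact_tens, ract_tens]
        | h2 t t' h h' => simp only [map_add, h, h']))
    (fun a x t => by
      induction t using tens_induction with
      | h1 y z => rfl
      | h2 t t' h h' => simp only [map_add, tens_add, h, h'])
    (fun a x t => by
      induction t using tens_induction with
      | h1 y z => rfl
      | h2 t t' h h' => simp only [map_add, tens_add, h, h'])
  hom_inv_id := tensor_hom_ext₃ fun x y z => rfl
  inv_hom_id := tensor_hom_ext fun x t => by
    induction t using tens_induction with
    | h1 y z => rfl
    | h2 t t' h h' => simp only [map_add, tens_add, h, h']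

@[simp] theorem assoc_hom_tens (x : X) (y : Y) (z : Z) :
    Hom.lin (assoc X Y Z).hom (tens (tens x y) z) = tens x (tens y z) := rfl

theorem lact_add_apply (X : FGCorr A) (a b : A) (x : X) :
    X.lact (a + b) x = X.lact a x + X.lact b x := by simp
theorem lact_smul_apply (X : FGCorr A) (z : ℂ) (a : A) (x : X) :
    X.lact (z • a) x = z • X.lact a x := by simp
theorem lact_mul_apply (X : FGCorr A) (a b : A) (x : X) :
    X.lact (a * b) x = X.lact a (X.lact b x) := by simp
theorem ract_add_apply (X : FGCorr A) (x : X) (a b : A) :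
    X.ract (op (a + b)) x = X.ract (op a) x + X.ract (op b) x := by simp
theorem ract_smul_apply (X : FGCorr A) (z : ℂ) (x : X) (a : A) :
    X.ract (op (z • a)) x = z • X.ract (op a) x := by simp
theorem ract_mul_apply (X : FGCorr A) (x : X) (a b : A) :
    X.ract (op (a * b)) x = X.ract (op b) (X.ract (op a) x) := by simp

/-- An element of `A`, regarded as an element of the trivial bimodule. -/
def toUnit (a : A) : unit A := a

/-- The isomorphism `a ⊗ x ↦ a x`. -/
def leftUnit (X : FGCorr A) : tensor (unit A) X ≅ X where
  hom := tensorHomMk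
    (tensLift (X := unit A) (fun a x => X.lact a x) (X.lact_add_apply) (X.lact_smul_apply)
      (by simp) (by simp) (X.lact_mul_apply))
    (X.lact_mul_apply)
    (fun a b x => X.lact_ract b a x)
  inv := mkHom
    { toFun := fun x => tens (toUnit 1) x
      map_add' := by simp [tens_add]
      map_smul' := by simp [tens_smul] }
    (fun a x => by
      refine (ract_tens (X := unit A) (toUnit (1 : A)) a x).symm.trans ?_
      change tens (toUnit (1 * a)) x = tens (toUnit (a * 1)) x
      rw [one_mul, mul_one])
    (fun a x => rfl)
  hom_inv_id := tensor_hom_ext fun a x => by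
    refine (ract_tens (X := unit A) (toUnit (1 : A)) a x).symm.trans ?_
    exact congrArg (fun b : A => tens (toUnit b) x) (one_mul (M := A) a)
  inv_hom_id := hom_ext fun x => congrArg (fun T => T x) (map_one X.lact)

/-- The isomorphism `x ⊗ a ↦ x a`. -/
def rightUnit (X : FGCorr A) : tensor X (unit A) ≅ X where
  hom := tensorHomMk
    (tensLift (Y := unit A) (fun x a => X.ract (op a) x) (by simp) (by simp)
      (X.ract_add_apply) (X.ract_smul_apply) (fun x a b => (X.ract_mul_apply x a b).symm))
    (fun a x b => (X.lact_ract a (op b) x).symm)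
    (fun a x b => X.ract_mul_apply x b a.unop)
  inv := mkHom
    { toFun := fun x => tens x (toUnit 1)
      map_add' := by simp [add_tens]
      map_smul' := by simp [smul_tens] }
    (fun a x => rfl)
    (fun a x => by
      refine (ract_tens x a.unop (toUnit 1)).trans ?_
      change tens x (toUnit (a.unop * 1)) = tens x (toUnit (1 * a.unop))
      rw [one_mul, mul_one])
  hom_inv_id := tensor_hom_ext fun x a => by
    refine (ract_tens (Y := unit A) x a (toUnit (1 : A))).trans ?_
    exact congrArg (fun b : A => tens x (toUnit b)) (mul_one (M := A) a)
  inv_hom_id := hom_ext fun x => congrArg (fun T => T x) (map_one X.ract)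

@[simp] theorem leftUnit_hom_tens (a : A) (x : X) :
    Hom.lin (leftUnit X).hom (tens (toUnit a) x) = X.lact a x := rfl
@[simp] theorem rightUnit_hom_tens (a : A) (x : X) :
    Hom.lin (rightUnit X).hom (tens x (toUnit a)) = X.ract (op a) x := rfl

/-- The tensor category of correspondences with finite projective bases. -/
instance : MonoidalCategory (FGCorr A) where
  tensorObj := tensor
  whiskerLeft X _ _ f := tensorMap (𝟙 X) f
  whiskerRight f Y := tensorMap f (𝟙 Y)
  tensorHom := tensorMap
  tensorUnit := unit A
  associator := assoc
  leftUnitor := leftUnit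
  rightUnitor := rightUnit
  tensorHom_def _ _ := tensor_hom_ext fun _ _ => rfl
  id_tensorHom_id _ _ := tensor_hom_ext fun _ _ => rfl
  tensorHom_comp_tensorHom _ _ _ _ := tensor_hom_ext fun _ _ => rfl
  whiskerLeft_id _ _ := tensor_hom_ext fun _ _ => rfl
  id_whiskerRight _ _ := tensor_hom_ext fun _ _ => rfl
  associator_naturality _ _ _ := tensor_hom_ext₃ fun _ _ _ => rfl
  leftUnitor_naturality f := tensor_hom_ext fun a x => (lin_lact f a x).symm
  rightUnitor_naturality f := tensor_hom_ext fun x a => (lin_ract f (op a) x).symm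
  pentagon _ _ _ _ := tensor_hom_ext₄ fun _ _ _ _ => rfl
  triangle _ _ := tensor_hom_ext₃ fun x a y => (ract_tens x a y).symm

end Monoidal

end FGCorr
end Corr

section Dagger

/-- Dagger categories. -/
class DaggerCategory (C : Type*) [Category C] where
  dagger : ∀ {X Y : C}, (X ⟶ Y) → (Y ⟶ X)
  dagger_id : ∀ X : C, dagger (𝟙 X) = 𝟙 X
  dagger_comp : ∀ {X Y Z : C} (f : X ⟶ Y) (g : Y ⟶ Z), dagger (f ≫ g) = dagger g ≫ dagger f
  dagger_dagger : ∀ {X Y : C} (f : X ⟶ Y), dagger (dagger f) = f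

instance {A : Type} [CStarAlgebra A] [PartialOrder A] [StarOrderedRing A] :
    DaggerCategory (FGCorr A) where
  dagger := FGCorr.dag
  dagger_id X := FGCorr.hom_ext fun y => FGCorr.ext_inner fun x => by
    rw [← FGCorr.inner_dag]; rfl
  dagger_comp f g := FGCorr.hom_ext fun y => FGCorr.ext_inner fun x => by
    rw [← FGCorr.inner_dag]
    simp only [FGCorr.lin_comp]
    rw [← FGCorr.inner_dag, ← FGCorr.inner_dag]
  dagger_dagger {X Y} f := FGCorr.hom_ext fun y => FGCorr.ext_inner fun x => by
    rw [← FGCorr.inner_dag, ← Y.star_inner, ← X.star_inner, FGCorr.inner_dag]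

instance {C : Type*} [Category C] [DaggerCategory C] (P : ObjectProperty C) :
    DaggerCategory P.FullSubcategory where
  dagger f := ObjectProperty.homMk (DaggerCategory.dagger f.hom)
  dagger_id X := by ext; exact DaggerCategory.dagger_id X.obj
  dagger_comp f g := by ext; exact DaggerCategory.dagger_comp f.hom g.hom
  dagger_dagger f := by ext; exact DaggerCategory.dagger_dagger f.hom

open Functor.LaxMonoidal Functor.OplaxMonoidal in
/-- Unitary tensor functors: monoidal functors that preserve the dagger and whose structure
isomorphisms `F X ⊗ F Y ≅ F (X ⊗ Y)` and `𝟙 ≅ F 𝟙` are unitary (`δ` and `η` are the inverses of `μ`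
and `ε`). -/
structure IsUnitaryTensorFunctor {C D : Type*} [Category C] [Category D] [MonoidalCategory C]
    [MonoidalCategory D] [DaggerCategory C] [DaggerCategory D] (F : C ⥤ D) [F.Monoidal] :
    Prop where
  map_dagger : ∀ {X Y : C} (f : X ⟶ Y),
    F.map (DaggerCategory.dagger f) = DaggerCategory.dagger (F.map f)
  dagger_μ : ∀ X Y : C, DaggerCategory.dagger (μ F X Y) = δ F X Y
  dagger_ε : DaggerCategory.dagger (ε F) = η F

end Dagger

section Hilb

/-- Finite-dimensional complex Hilbert spaces. -/
structure HilbFd where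
  carrier : Type
  [normedAddCommGroup : NormedAddCommGroup carrier]
  [innerProductSpace : InnerProductSpace ℂ carrier]
  [finiteDimensional : FiniteDimensional ℂ carrier]

attribute [instance] HilbFd.normedAddCommGroup HilbFd.innerProductSpace HilbFd.finiteDimensional

namespace HilbFd

instance : CoeSort HilbFd Type := ⟨HilbFd.carrier⟩

instance : Category HilbFd where
  Hom E F := E →ₗ[ℂ] F
  id E := LinearMap.id
  comp f g := g ∘ₗ f

instance (E F : HilbFd) : AddCommGroup (E ⟶ F) := inferInstanceAs (AddCommGroup (E →ₗ[ℂ] F))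
instance (E F : HilbFd) : Module ℂ (E ⟶ F) := inferInstanceAs (Module ℂ (E →ₗ[ℂ] F))

instance : Preadditive HilbFd where
  add_comp _ _ _ f f' g := LinearMap.comp_add f f' g
  comp_add _ _ _ f g g' := LinearMap.add_comp f g' g

instance : Linear ℂ HilbFd where
  smul_comp _ _ _ z f g := LinearMap.comp_smul g z f
  comp_smul _ _ _ f z g := LinearMap.smul_comp z g f

/-- The linear map underlying a morphism. -/
def lin {E F : HilbFd} (f : E ⟶ F) : E →ₗ[ℂ] F := f

/-- An isomorphism from a linear equivalence. -/
def isoMk {E F : HilbFd} (e : E ≃ₗ[ℂ] F) : E ≅ F where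
  hom := e.toLinearMap
  inv := e.symm.toLinearMap
  hom_inv_id := LinearMap.ext e.symm_apply_apply
  inv_hom_id := LinearMap.ext e.apply_symm_apply

instance : MonoidalCategory HilbFd where
  tensorObj E F := ⟨E ⊗[ℂ] F⟩
  whiskerLeft _ _ _ f := TensorProduct.map LinearMap.id (lin f)
  whiskerRight f _ := TensorProduct.map (lin f) LinearMap.id
  tensorHom f g := TensorProduct.map (lin f) (lin g)
  tensorUnit := ⟨ℂ⟩
  associator E F G := isoMk (TensorProduct.assoc ℂ E F G)
  leftUnitor E := isoMk (TensorProduct.lid ℂ E)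
  rightUnitor E := isoMk (TensorProduct.rid ℂ E)
  tensorHom_def _ _ := TensorProduct.ext' fun _ _ => rfl
  id_tensorHom_id _ _ := TensorProduct.ext' fun _ _ => rfl
  tensorHom_comp_tensorHom _ _ _ _ := TensorProduct.ext' fun _ _ => rfl
  whiskerLeft_id _ _ := TensorProduct.ext' fun _ _ => rfl
  id_whiskerRight _ _ := TensorProduct.ext' fun _ _ => rfl
  associator_naturality _ _ _ := TensorProduct.ext_threefold fun _ _ _ => rfl
  leftUnitor_naturality f := TensorProduct.ext' fun z x => ((lin f).map_smul z x).symm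
  rightUnitor_naturality f := TensorProduct.ext' fun x z => ((lin f).map_smul z x).symm
  pentagon _ _ _ _ := TensorProduct.ext_fourfold fun _ _ _ _ => rfl
  triangle _ _ := TensorProduct.ext_threefold fun x z y => (TensorProduct.smul_tmul z x y).symm

instance : BraidedCategory HilbFd where
  braiding E F := isoMk (TensorProduct.comm ℂ E F)
  braiding_naturality_right _ _ _ _ := TensorProduct.ext' fun _ _ => rfl
  braiding_naturality_left _ _ := TensorProduct.ext' fun _ _ => rfl
  hexagon_forward _ _ _ := TensorProduct.ext_threefold fun _ _ _ => rfl
  hexagon_reverse E F G := by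
    rw [← cancel_epi (MonoidalCategoryStruct.associator E F G).hom]
    exact TensorProduct.ext_threefold fun _ _ _ => rfl

instance : DaggerCategory HilbFd where
  dagger f := LinearMap.adjoint (lin f)
  dagger_id _ := LinearMap.adjoint_id
  dagger_comp f g := LinearMap.adjoint_comp (lin g) (lin f)
  dagger_dagger f := LinearMap.adjoint_adjoint (lin f)

end HilbFd
end Hilb

section DHR

variable {A : Type} [CStarAlgebra A] [PartialOrder A] [StarOrderedRing A]
  (loc : Finset ℤ → StarSubalgebra ℂ A)

/-- `A_{Iᶜ}`: the C*-algebra generated by the local algebras of the bounded intervals disjoint from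
`I`. -/
def complAlg (I : Finset ℤ) : StarSubalgebra ℂ A :=
  (⨆ (p : ℤ) (q : ℤ) (_ : Disjoint (Finset.Icc p q) I), loc (Finset.Icc p q)).topologicalClosure

/-- `[A_{Iᶜ}, x] = 0`. -/
def IsLocalized (I : Finset ℤ) {X : FGCorr A} (x : X) : Prop :=
  ∀ a ∈ complAlg loc I, X.lact a x = X.ract (op a) x

/-- DHR bimodules: for every sufficiently large interval `I` there is a finite projective basis
whose elements commute with `A_{Iᶜ}`. -/
def IsDHR : ObjectProperty (FGCorr A) := fun X =>
  ∃ R : ℕ, ∀ p q : ℤ, R ≤ (Finset.Icc p q).card →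
    ∃ (n : ℕ) (b : Fin n → X), IsProjBasis X.ract X.inner b ∧
      ∀ i, IsLocalized loc (Finset.Icc p q) (b i)

instance : (IsDHR loc).IsMonoidal where
  prop_unit := ⟨0, fun p q _ => ⟨1, _, FGCorr.unit_basis, fun i a _ => by
    change a * 1 = 1 * a
    rw [mul_one, one_mul]⟩⟩
  prop_tensor X Y := by
    rintro ⟨R, hR⟩ ⟨S, hS⟩
    refine ⟨max R S, fun p q h => ?_⟩
    obtain ⟨n, b, hb, hbl⟩ := hR p q (le_of_max_le_left h)
    obtain ⟨m, c, hc, hcl⟩ := hS p q (le_of_max_le_right h)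
    refine ⟨n * m, _, FGCorr.Bal.basis hb hc, fun k a ha => ?_⟩
    change FGCorr.tens (X.lact a (b _)) (c _) = FGCorr.tens (b _) (Y.ract (op a) (c _))
    rw [hbl _ a ha, FGCorr.ract_tens, hcl _ a ha]

/-- The tensor category of DHR bimodules. -/
abbrev DHR : Type 1 := (IsDHR loc).FullSubcategory

/-- Dualizable objects: there are a right dual and a left dual among the DHR bimodules. -/
def IsDualizable : ObjectProperty (DHR loc) := fun X =>
  (∃ Y, Nonempty (ExactPairing X Y)) ∧ ∃ Y, Nonempty (ExactPairing Y X)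

open MonoidalCategory in
instance : (IsDualizable loc).IsMonoidal where
  prop_unit := ⟨⟨𝟙_ _, ⟨inferInstance⟩⟩, ⟨𝟙_ _, ⟨inferInstance⟩⟩⟩
  prop_tensor X X' := by
    rintro ⟨⟨Y, ⟨h⟩⟩, ⟨Z, ⟨k⟩⟩⟩ ⟨⟨Y', ⟨h'⟩⟩, ⟨Z', ⟨k'⟩⟩⟩
    exact ⟨⟨Y' ⊗ Y, ⟨inferInstance⟩⟩, ⟨Z' ⊗ Z, ⟨inferInstance⟩⟩⟩

/-- The tensor category of dualizable DHR bimodules. -/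
abbrev DHR₀ : Type 1 := (IsDualizable loc).FullSubcategory

/-- The underlying correspondence. -/
def DHR₀.corr {loc : Finset ℤ → StarSubalgebra ℂ A} (X : DHR₀ loc) : FGCorr A := X.obj.obj

open MonoidalCategory in
/-- The DHR braiding: the braiding that maps `x ⊗ y` to `y ⊗ x` whenever `x` is localized in an
interval `I` and `y` is localized in an interval `J` sufficiently far to the right of `I`. As DHR
bimodules have projective bases localized in any sufficiently large interval, there is at most one
such braiding. -/
def IsDHRBraiding [BraidedCategory (DHR₀ loc)] : Prop :=
  ∀ X Y : DHR₀ loc, ∃ R : ℕ, ∀ p q r s : ℤ,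
    (∀ i ∈ Finset.Icc p q, ∀ j ∈ Finset.Icc r s, i + R < j) →
    ∀ (x : X.corr) (y : Y.corr),
      IsLocalized loc (Finset.Icc p q) x → IsLocalized loc (Finset.Icc r s) y →
      FGCorr.Hom.lin (β_ X Y).hom.hom.hom (FGCorr.tens x y) = FGCorr.tens y x

end DHR

end RotorChain
end

/-! The left action on a dualizable DHR bimodule `X` is, on a large interval `I`, a multiple of the
identity representation of a type I factor. The multiplicity space is the space of central vectors
of `X`, those with `a ξ = ξ a` for all `a`, and everything about `X` can be read off from it.

Take a projective basis `b i` localized in `I`, and let `H` be the Hilbert space of `I`. The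
coefficients `⟨b i, a b j⟩`, `a` in the local algebra `B(H)`, commute with the algebra of the
complement, so by Haag duality (`mem_loc_of_commute`) they lie in `B(H)` again. They form a
*-representation `π` of `B(H)` on the separable space `H ⊗ ℂⁿ`, with `π(1)` the projection `(⟨b i, b
j⟩)`. Such a representation is normal (`rep_normal`): an almost disjoint family of subsets of a
countable set gives uncountably many isometries `V_x` for which `V_x* V_y` has finite rank when `x ≠
y`, and a vector killed by all matrix units but not by `π(1)` would be sent by them to uncountably
many orthogonal vectors of equal length. Hence `π(1) = ∑ V_m V_m*` with isometric intertwiners `V_m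
: H → H ⊗ ℂⁿ` (`rep_decomposition`). The components of `V_m` are elements of the local algebra, and
`ξ_m = ∑ b i (V_m)_i` are orthonormal central vectors which form a projective basis
(`isProjBasis_centralVec`).

Since `H` is infinite-dimensional the multiplicity could be infinite. Dualizability excludes this:
the two halves of a dual pairing bound the number of orthonormal central vectors
(`card_le_of_dual`). So `X` has a finite orthonormal basis of central vectors and is free.

The center of `L^∞` is trivial (`eq_vac_of_central`), so inner products of central vectors are
scalars. Taking central vectors is then a fully faithful unitary tensor functor onto
finite-dimensional Hilbert spaces, and the flip is transported along it. Localized vectors have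
localized coefficients in a central basis; those of disjoint intervals commute, so the transported
braiding flips the vectors themselves (`flip_of_isLocalized`). -/

noncomputable section
namespace RotorChain

/-! ### Matrix coefficients and amplifications of operators on `ℓ²` -/

section Ket
variable {α β γ : Type}

open Classical in
/-- The standard basis vector `e_s` of `ℓ²(α)`. -/
def ket (s : α) : L2 α := lp.single 2 s 1

theorem ket_apply (s t : α) [Decidable (t = s)] :
    (ket s : L2 α) t = if t = s then 1 else 0 := by
  classical
  rw [ket, lp.single_apply]
  split_ifs with h
  · subst h; exact Pi.single_eq_same _ _
  · exact Pi.single_eq_of_ne h _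

theorem inner_ket (s : α) (f : L2 α) : ⟪ket s, f⟫_ℂ = f s := by
  classical
  rw [ket]
  have := lp.inner_single_left (𝕜 := ℂ) s (1 : ℂ) f
  convert this using 1
  simp

theorem norm_ket (s : α) : ‖(ket s : L2 α)‖ = 1 := by
  classical
  rw [ket, lp.norm_single (by norm_num), norm_one]

/-- A bounded operator is determined by its matrix coefficients. -/
theorem clm_ext_ket {T T' : L2 α →L[ℂ] L2 β} (h : ∀ s t, T (ket s) t = T' (ket s) t) : T = T' := by
  -- It suffices that the adjoints agree on basis vectors, because `(T f)(t) = ⟨T* e_t, f⟩` for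
  -- every `f`.
  have key : ∀ t, ContinuousLinearMap.adjoint T (ket t) = ContinuousLinearMap.adjoint T' (ket t) := by
    intro t
    ext s
    rw [← inner_ket, ← inner_ket, ContinuousLinearMap.adjoint_inner_right,
      ContinuousLinearMap.adjoint_inner_right, ← inner_conj_symm, inner_ket,
      ← inner_conj_symm (T' _), inner_ket, h]
  ext f t
  rw [← inner_ket, ← inner_ket, ← ContinuousLinearMap.adjoint_inner_left, key,
    ContinuousLinearMap.adjoint_inner_left]

/-- The matrix unit `|e_s⟩⟨e_t|`. -/
def matUnit (s t : α) : L2 α →L[ℂ] L2 α := InnerProductSpace.rankOne ℂ (ket s) (ket t)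

theorem matUnit_apply (s t : α) (f : L2 α) : matUnit s t f = f t • ket s := by
  rw [matUnit, InnerProductSpace.rankOne_apply, inner_ket]

/-- `slice` as a bounded operator. -/
def sliceCLM (e : γ ≃ α × β) (b : β) : L2 γ →L[ℂ] L2 α :=
  LinearMap.mkContinuous
    { toFun := slice e b, map_add' := slice_add e b, map_smul' := slice_smul e b } 1 fun ξ => by
      rw [one_mul]
      refine le_of_sq_le_sq ?_ (norm_nonneg _)
      exact le_hasSum (hasSum_norm_slice e ξ) b fun _ _ => by positivity

theorem sliceCLM_apply (e : γ ≃ α × β) (b : β) (ξ : L2 γ) (a : α) :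
    sliceCLM e b ξ a = ξ (e.symm (a, b)) := rfl

theorem adjoint_sliceCLM_ket (e : γ ≃ α × β) (b : β) (a : α) :
    ContinuousLinearMap.adjoint (sliceCLM e b) (ket a) = ket (e.symm (a, b)) := by
  classical
  ext c
  rw [← inner_ket, ContinuousLinearMap.adjoint_inner_right, ← inner_conj_symm, inner_ket,
    sliceCLM_apply, ket_apply, ket_apply]
  simp [apply_ite, eq_comm]

theorem ampl_apply (e : γ ≃ α × β) (S : L2 α →L[ℂ] L2 α) (ξ : L2 γ) (c : γ) :
    ampl e S ξ c = S (slice e (e c).2 ξ) (e c).1 := rfl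

theorem ampl_injective (e : γ ≃ α × β) [Nonempty β] : Function.Injective (ampl e) := by
  intro S S' h
  refine clm_ext_ket fun s t => ?_
  -- For any fixed `b`, the `(t, s)` coefficient of `S` is the `((t, b), (s, b))` coefficient of `S
  -- ⊗ 1`.
  obtain ⟨b⟩ := ‹Nonempty β›
  have hk : slice e b (ket (e.symm (s, b))) = ket s := by
    classical
    ext a
    change (ket (e.symm (s, b)) : L2 γ) (e.symm (a, b)) = _
    simp [ket_apply]
  have := congrArg (fun T : L2 γ →L[ℂ] L2 γ => T (ket (e.symm (s, b))) (e.symm (t, b))) h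
  simpa [ampl_apply, hk] using this

end Ket

/-! ### Matrix units at finitely many sites and Haag duality for operators -/

section UnitOp

/-- The configuration that agrees with `β` on `F` and with `c` elsewhere. -/
def upd (F : Finset ℤ) (β : ℤ → ℕ) (c : Config) : Config :=
  (splitConfig F).symm (fun i => β i, (splitConfig F c).2)

theorem splitConfig_symm_apply (F : Finset ℤ) (p) (i : ℤ) :
    (splitConfig F).symm p i = if h : i ∈ F then p.1 ⟨i, h⟩ else p.2 ⟨i, h⟩ := by
  classical
  by_cases h : i ∈ F <;> simp [splitConfig, Finsupp.extendDomain, h]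

theorem upd_apply (F : Finset ℤ) (β : ℤ → ℕ) (c : Config) (i : ℤ) :
    upd F β c i = if i ∈ F then β i else c i := by
  rw [upd, splitConfig_symm_apply]
  by_cases h : i ∈ F <;> simp [h, splitConfig]

/-- The operator `|α⟩⟨β| ⊗ 1` localized in `F`. -/
def unitOp (F : Finset ℤ) (α β : ℤ → ℕ) : L2 Config →L[ℂ] L2 Config :=
  ampl (splitConfig F) (matUnit (fun i => α i) (fun i => β i))

theorem unitOp_apply (F : Finset ℤ) (α β : ℤ → ℕ) (ξ : L2 Config) (c : Config) :
    unitOp F α β ξ c = if ∀ i ∈ F, c i = α i then ξ (upd F β c) else 0 := by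
  classical
  rw [unitOp, ampl_apply, matUnit_apply, lp.coeFn_smul, Pi.smul_apply, ket_apply]
  have h : ((splitConfig F c).1 = fun i : F => α i) ↔ ∀ i ∈ F, c i = α i := by
    simp [funext_iff, splitConfig]
  simp only [h, smul_eq_mul, mul_ite, mul_one, mul_zero]
  rfl

theorem unitOp_empty (α β : ℤ → ℕ) : unitOp ∅ α β = 1 := by
  ext ξ c
  rw [unitOp_apply, if_pos (by simp)]
  exact congrArg ξ (Finsupp.ext fun i => by simp [upd_apply])

/-- The matrix units of a finite region are products of single-site ones, so commutation only has to
be tested site by site. -/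
theorem unitOp_union {F G : Finset ℤ} (h : Disjoint F G) (α β : ℤ → ℕ) :
    unitOp (F ∪ G) α β = unitOp F α β * unitOp G α β := by
  ext ξ c
  have hG : (∀ i ∈ G, upd F β c i = α i) ↔ ∀ i ∈ G, c i = α i :=
    forall₂_congr fun i hi => by rw [upd_apply, if_neg (Finset.disjoint_right.1 h hi)]
  have hu : upd (F ∪ G) β c = upd G β (upd F β c) := Finsupp.ext fun i => by
    simp only [upd_apply, Finset.mem_union]; split_ifs <;> tauto
  rw [mul_apply_eq_comp, unitOp_apply, unitOp_apply, unitOp_apply, ← ite_and]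
  simp only [hG, hu, Finset.mem_union, or_imp, forall_and]

theorem commute_unitOp {F G : Finset ℤ} (h : Disjoint F G) (α β α' β' : ℤ → ℕ) :
    Commute (unitOp F α β) (unitOp G α' β') := by
  ext ξ c
  have h1 : (∀ i ∈ G, upd F β c i = α' i) ↔ ∀ i ∈ G, c i = α' i :=
    forall₂_congr fun i hi => by rw [upd_apply, if_neg (Finset.disjoint_right.1 h hi)]
  have h2 : (∀ i ∈ F, upd G β' c i = α i) ↔ ∀ i ∈ F, c i = α i :=
    forall₂_congr fun i hi => by rw [upd_apply, if_neg (Finset.disjoint_left.1 h hi)]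
  have hu : upd G β' (upd F β c) = upd F β (upd G β' c) := Finsupp.ext fun i => by
    have : i ∈ F → i ∉ G := fun hi => Finset.disjoint_left.1 h hi
    simp only [upd_apply]; split_ifs <;> tauto
  simp only [mul_apply_eq_comp, unitOp_apply, ← ite_and, h1, h2, hu, and_comm]

theorem unitOp_ket (F : Finset ℤ) (α β : ℤ → ℕ) (d : Config) (h : ∀ i ∈ F, d i = β i) :
    unitOp F α β (ket d) = ket (upd F α d) := by
  classical
  ext c
  rw [unitOp_apply, ket_apply, ket_apply, ← ite_and]
  refine if_congr ⟨fun ⟨h1, h2⟩ => ?_, fun h1 => ?_⟩ rfl rfl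
  · refine Finsupp.ext fun i => ?_
    have := DFunLike.congr_fun h2 i
    rw [upd_apply] at this ⊢
    split_ifs at this ⊢ with hi
    · exact h1 i hi
    · exact this
  · subst h1
    refine ⟨fun i hi => by rw [upd_apply, if_pos hi], Finsupp.ext fun i => ?_⟩
    rw [upd_apply, upd_apply]
    split_ifs with hi
    · exact (h i hi).symm
    · rfl

/-- An operator that commutes with all matrix units at sites outside `F` is localized in `F`. -/
theorem mem_localOp_of_commute (F : Finset ℤ) (T : L2 Config →L[ℂ] L2 Config)
    (hT : ∀ j ∉ F, ∀ α β : ℤ → ℕ, Commute T (unitOp {j} α β)) : T ∈ localOp F := by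
  classical
  -- Commuting with the projection `|d j⟩⟨d j|` at `j` means that `T` preserves the occupation
  -- number at `j`.
  have hzero : ∀ j ∉ F, ∀ c d : Config, c j ≠ d j → T (ket d) c = 0 := by
    intro j hj c d hcd
    have h1 : unitOp {j} d d (ket d) = ket d := by
      rw [unitOp_ket _ _ _ _ (by simp)]
      congr 1
      exact Finsupp.ext fun i => by rw [upd_apply]; simp
    have h2 := congrArg (fun S : L2 Config →L[ℂ] L2 Config => S (ket d) c) (hT j hj d d)
    simp only [mul_apply_eq_comp, h1] at h2
    rw [h2, unitOp_apply, if_neg (by simpa using hcd)]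
  -- Commuting with `|α j⟩⟨d j|` means that a coefficient does not depend on the common value of the
  -- two configurations at `j`.
  have hmove : ∀ j ∉ F, ∀ c d : Config, c j = d j → ∀ α : ℤ → ℕ,
      T (ket d) c = T (ket (upd {j} α d)) (upd {j} α c) := by
    intro j hj c d hcd α
    have h1 := unitOp_ket {j} α d d (by simp)
    have h2 := congrArg (fun S : L2 Config →L[ℂ] L2 Config => S (ket d) (upd {j} α c))
      (hT j hj α d)
    simp only [mul_apply_eq_comp, h1] at h2
    rw [h2, unitOp_apply, if_pos (by simp [upd_apply])]
    have hc : upd {j} d (upd {j} α c) = c := Finsupp.ext fun i => by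
      simp only [upd_apply, Finset.mem_singleton]; split_ifs with h <;> simp_all
    rw [hc]
  -- As configurations have finite support, finitely many moves bring both of them to the value `0`
  -- everywhere outside `F`.
  have hmoves : ∀ G : Finset ℤ, Disjoint F G → ∀ c d : Config, (∀ i ∈ G, c i = d i) →
      T (ket d) c = T (ket (upd G 0 d)) (upd G 0 c) := by
    intro G
    induction G using Finset.induction_on with
    | empty =>
      intro _ c d _
      have : ∀ c, upd ∅ 0 c = c := fun c => Finsupp.ext fun i => by simp [upd_apply]
      rw [this, this]
    | insert j G hj ih =>
      intro h c d hcd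
      rw [Finset.disjoint_insert_right] at h
      have hu : ∀ c, upd (insert j G) 0 c = upd {j} 0 (upd G 0 c) := fun c =>
        Finsupp.ext fun i => by
          simp only [upd_apply, Finset.mem_insert, Finset.mem_singleton]
          split_ifs <;> simp_all
      rw [ih h.2 c d fun i hi => hcd i (Finset.mem_insert_of_mem hi), hu, hu]
      refine hmove j h.1 _ _ ?_ 0
      simp only [upd_apply, hcd j (Finset.mem_insert_self _ _)]
  set e := splitConfig F
  -- The operator on `F` is the compression `(1 ⊗ ⟨e_0|) T (1 ⊗ |e_0⟩)` of `T` to the vacuum outside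
  -- `F`.
  refine ⟨sliceCLM e 0 ∘L T ∘L ContinuousLinearMap.adjoint (sliceCLM e 0), ?_⟩
  refine clm_ext_ket fun d c => ?_
  change (sliceCLM e 0 (T (ContinuousLinearMap.adjoint (sliceCLM e 0)
    (slice e (e c).2 (ket d))))) (e c).1 = T (ket d) c
  by_cases hcd : (e c).2 = (e d).2
  · have h1 : slice e (e c).2 (ket d) = ket (e d).1 := by
      ext a
      change (ket d : L2 Config) (e.symm (a, (e c).2)) = _
      rw [ket_apply, ket_apply, hcd]
      refine if_congr ?_ rfl rfl
      rw [Equiv.symm_apply_eq]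
      simp [Prod.ext_iff]
    rw [h1, adjoint_sliceCLM_ket, sliceCLM_apply]
    have hout : ∀ i ∉ F, c i = d i := fun i hi => DFunLike.congr_fun hcd ⟨i, hi⟩
    rw [hmoves ((c.support ∪ d.support) \ F) Finset.disjoint_sdiff c d
      fun i hi => hout i (Finset.mem_sdiff.1 hi).2]
    have hz : ∀ c' : Config, c'.support ⊆ c.support ∪ d.support →
        e.symm ((e c').1, 0) = upd ((c.support ∪ d.support) \ F) 0 c' := by
      intro c' hc'
      refine Finsupp.ext fun i => ?_
      rw [splitConfig_symm_apply, upd_apply]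
      by_cases hi : i ∈ F
      · simp [hi, e, splitConfig]
      · by_cases hci : i ∈ c.support ∪ d.support
        · rw [if_pos (Finset.mem_sdiff.2 ⟨hci, hi⟩)]; simp [hi]
        · rw [if_neg (by simp_all)]
          simp [hi, Finsupp.notMem_support_iff.1 fun h => hci (hc' h)]
    rw [hz c Finset.subset_union_left, hz d Finset.subset_union_right]
  · have h1 : slice e (e c).2 (ket d) = 0 := by
      ext a
      change (ket d : L2 Config) (e.symm (a, (e c).2)) = 0
      rw [ket_apply, if_neg]
      intro h
      rw [← h, Equiv.apply_symm_apply] at hcd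
      exact hcd rfl
    rw [h1]
    obtain ⟨i, hi⟩ : ∃ i : {i : ℤ // i ∉ F}, (e c).2 i ≠ (e d).2 i := by
      by_contra hcon
      push Not at hcon
      exact hcd (Finsupp.ext hcon)
    rw [hzero i i.2 c d hi]
    simp

end UnitOp

/-! ### Elements of the algebra that commute with a given vector -/

namespace FGCorr
section Commutant
variable {A : Type} [CStarAlgebra A] [PartialOrder A] [StarOrderedRing A] {X Y : FGCorr A}

/-- Write `‖a‖² - a* a = c* c`; the difference of the two sides is `⟨c x, c x⟩`. -/
theorem inner_lact_self_le (a : A) (x : X) :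
    X.inner (X.lact a x) (X.lact a x) ≤ ((‖a‖ ^ 2 : ℝ) : ℂ) • X.inner x x := by
  have h : 0 ≤ algebraMap ℝ A (‖a‖ ^ 2) - star a * a :=
    sub_nonneg.2 CStarAlgebra.star_mul_le_algebraMap_norm_sq
  obtain ⟨c, hc⟩ := CStarAlgebra.nonneg_iff_eq_star_mul_self.1 h
  have h1 : ∀ d : A, X.inner (X.lact d x) (X.lact d x) = X.inner x (X.lact (star d * d) x) := by
    intro d; rw [X.inner_lact, map_mul]; rfl
  have h2 := X.inner_self_nonneg (X.lact c x)
  rw [h1, ← hc, map_sub, LinearMap.sub_apply, map_sub, sub_nonneg, ← h1] at h2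
  refine h2.trans (le_of_eq ?_)
  have : algebraMap ℝ A (‖a‖ ^ 2) = ((‖a‖ ^ 2 : ℝ) : ℂ) • (1 : A) := by
    rw [Algebra.algebraMap_eq_smul_one, Complex.coe_smul]
  rw [this, map_smul, map_one, LinearMap.smul_apply, map_smul]
  rfl

/-- By the parallelogram identity the difference of the two sides is `⟨x + y, x + y⟩`. -/
theorem inner_sub_self_le (x y : X) :
    X.inner (x - y) (x - y) ≤ (2 : ℂ) • X.inner x x + (2 : ℂ) • X.inner y y := by
  have h := X.inner_self_nonneg (x + y)
  rw [← sub_nonneg]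
  convert h using 1
  simp only [map_add, map_sub, LinearMap.add_apply, LinearMap.sub_apply, two_smul]
  abel

theorem norm_inner_comm_le (a : A) (x : X) :
    ‖X.inner (X.lact a x - X.ract (op a) x) (X.lact a x - X.ract (op a) x)‖ ≤
      4 * ‖a‖ ^ 2 * ‖X.inner x x‖ := by
  have h1 := CStarAlgebra.norm_le_norm_of_nonneg_of_le (X.inner_self_nonneg _)
    (inner_sub_self_le (X.lact a x) (X.ract (op a) x))
  have h2 := CStarAlgebra.norm_le_norm_of_nonneg_of_le (X.inner_self_nonneg _)
    (inner_lact_self_le a x)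
  have h3 : ‖X.inner (X.ract (op a) x) (X.ract (op a) x)‖ ≤ ‖a‖ ^ 2 * ‖X.inner x x‖ := by
    rw [X.inner_ract, ← X.star_inner, X.inner_ract, star_mul]
    refine (norm_mul_le _ _).trans ?_
    refine (mul_le_mul_of_nonneg_right (norm_mul_le _ _) (norm_nonneg _)).trans (le_of_eq ?_)
    rw [norm_star, X.star_inner]; ring
  have h4 : ‖((‖a‖ ^ 2 : ℝ) : ℂ) • X.inner x x‖ = ‖a‖ ^ 2 * ‖X.inner x x‖ := by
    rw [norm_smul, Complex.norm_real, Real.norm_of_nonneg (by positivity)]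
  rw [h4] at h2
  refine h1.trans ((norm_add_le _ _).trans ?_)
  rw [norm_smul, norm_smul]
  norm_num
  linarith

/-- The elements `a` of `A` with `a x = x a`. -/
def commSub (x : X) : Subalgebra ℂ A where
  carrier := {a | X.lact a x = X.ract (op a) x}
  mul_mem' := fun {a b} ha hb => by
    change X.lact (a * b) x = X.ract (op (a * b)) x
    rw [X.lact_mul_apply, X.ract_mul_apply, hb, X.lact_ract, ha]
  add_mem' := fun {a b} ha hb => by
    change X.lact (a + b) x = X.ract (op (a + b)) x
    rw [X.lact_add_apply, X.ract_add_apply, hb, ha]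
  algebraMap_mem' z := by
    change X.lact (algebraMap ℂ A z) x = X.ract (op (algebraMap ℂ A z)) x
    rw [← MulOpposite.algebraMap_apply, AlgHom.commutes, AlgHom.commutes]

theorem mem_commSub {x : X} {a : A} : a ∈ commSub x ↔ X.lact a x = X.ract (op a) x := Iff.rfl

/-- The map `a ↦ a x - x a` is linear and bounded for the module norm, by `norm_inner_comm_le`. -/
theorem isClosed_commSub (x : X) : IsClosed (commSub x : Set A) := by
  refine isClosed_of_closure_subset fun a ha => ?_
  rw [Metric.mem_closure_iff] at ha
  rw [SetLike.mem_coe, mem_commSub, ← sub_eq_zero]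
  apply X.inner_self_eq_zero
  rw [← norm_le_zero_iff]
  refine le_of_forall_pos_le_add fun ε hε => ?_
  set M := ‖X.inner x x‖ with hM
  have hM0 : 0 ≤ M := norm_nonneg _
  -- The radius is chosen so that `4 ‖a - b‖² M ≤ ε`; the denominator has `M + 1` because `M` may
  -- vanish.
  obtain ⟨b, hb, hab⟩ := ha (√(ε / (4 * (M + 1)))) (by positivity)
  rw [dist_eq_norm] at hab
  have hd : X.lact a x - X.ract (op a) x =
      X.lact (a - b) x - X.ract (op (a - b)) x := by
    rw [map_sub, MulOpposite.op_sub, map_sub, LinearMap.sub_apply, LinearMap.sub_apply, mem_commSub.1 hb]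
    abel
  rw [hd, zero_add]
  refine (norm_inner_comm_le _ _).trans ?_
  have h2 : ‖a - b‖ ^ 2 ≤ ε / (4 * (M + 1)) := by
    rw [← Real.sq_sqrt (show 0 ≤ ε / (4 * (M + 1)) by positivity)]
    gcongr
  rw [le_div_iff₀ (by positivity)] at h2
  nlinarith [sq_nonneg ‖a - b‖]

/-- The elements `a` of `A` with `a x = x a` and `a* x = x a*`. -/
def commStar (x : X) : StarSubalgebra ℂ A where
  carrier := {a | a ∈ commSub x ∧ star a ∈ commSub x}
  mul_mem' ha hb := ⟨mul_mem ha.1 hb.1, by rw [star_mul]; exact mul_mem hb.2 ha.2⟩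
  add_mem' ha hb := ⟨add_mem ha.1 hb.1, by rw [star_add]; exact add_mem ha.2 hb.2⟩
  algebraMap_mem' z := ⟨Subalgebra.algebraMap_mem _ z, by
    rw [← algebraMap_star_comm]; exact Subalgebra.algebraMap_mem _ _⟩
  star_mem' ha := ⟨ha.2, by rw [star_star]; exact ha.1⟩

theorem isClosed_commStar (x : X) : IsClosed (commStar x : Set A) :=
  (isClosed_commSub x).inter ((isClosed_commSub x).preimage continuous_star)

theorem le_commStar {B : StarSubalgebra ℂ A} {x : X} (h : ∀ a ∈ B, a ∈ commSub x) :
    B ≤ commStar x := fun _ ha => ⟨h _ ha, h _ (star_mem ha)⟩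

theorem isLocalized_iff {loc : Finset ℤ → StarSubalgebra ℂ A} {I : Finset ℤ} {x : X} :
    IsLocalized loc I x ↔ complAlg loc I ≤ commStar x :=
  ⟨fun h => le_commStar h, fun h _ ha => (h ha).1⟩

theorem isLocalized_of_le {loc : Finset ℤ → StarSubalgebra ℂ A} {I : Finset ℤ} {x : X}
    (h : ∀ p q, Disjoint (Finset.Icc p q) I → loc (Finset.Icc p q) ≤ commStar x) :
    IsLocalized loc I x :=
  isLocalized_iff.2 (StarSubalgebra.topologicalClosure_minimal
    (iSup_le fun p => iSup_le fun q => iSup_le fun hpq => h p q hpq) (isClosed_commStar x))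

/-- In the trivial bimodule, commuting with a vector is commuting with an element of the algebra.
Results on localized vectors thereby yield locality and related facts about `L^∞` itself. -/
theorem mem_commSub_unit {a b : A} : b ∈ commSub (X := unit A) (toUnit a) ↔ b * a = a * b := Iff.rfl

/-- Elements that commute with the algebra generated by the entries of the inner product. -/
theorem commute_inner {x y : X} {a : A} (hx : star a ∈ commSub x) (hy : a ∈ commSub y) :
    X.inner x y * a = a * X.inner x y := by
  rw [← X.inner_ract, ← mem_commSub.1 hy]
  have h := X.inner_lact (star a) x y
  rw [star_star] at h
  rw [← h, mem_commSub.1 hx, ← X.star_inner, X.inner_ract, star_mul, star_star, X.star_inner]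

end Commutant
end FGCorr

open FGCorr

/-! ### Locality, Haag duality and the trivial center of `L^∞` -/

section LInfLemmas

theorem isClosed_quasiLocal : IsClosed (quasiLocal : Set (L2 Config →L[ℂ] L2 Config)) :=
  StarSubalgebra.isClosed_topologicalClosure _

theorem incl_injective : Function.Injective LInf.incl := Subtype.val_injective

theorem localOp_le (p q : ℤ) : localOp (Finset.Icc p q) ≤ quasiLocal :=
  (le_iSup₂ (f := fun p q => localOp (Finset.Icc p q)) p q).trans
    (StarSubalgebra.le_topologicalClosure _)

/-- The embedding `B(ℓ²(ℕ)^{⊗I}) → L^∞` of a local algebra. -/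
def LInf.embed (p q : ℤ) :
    (L2 (Finset.Icc p q → ℕ) →L[ℂ] L2 (Finset.Icc p q → ℕ)) →⋆ₐ[ℂ] LInf :=
  StarAlgHom.codRestrict (ampl (splitConfig (Finset.Icc p q))) quasiLocal
    fun S => localOp_le p q ⟨S, rfl⟩

theorem embed_injective (p q : ℤ) : Function.Injective (LInf.embed p q) := fun _ _ h =>
  ampl_injective (splitConfig (Finset.Icc p q)) (congrArg LInf.incl h)

theorem mem_loc_iff {p q : ℤ} {a : LInf} :
    a ∈ LInf.loc (Finset.Icc p q) ↔ ∃ S, LInf.embed p q S = a :=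
  ⟨fun ⟨S, hS⟩ => ⟨S, incl_injective hS⟩, fun ⟨S, hS⟩ => ⟨S, congrArg LInf.incl hS⟩⟩

/-- The matrix unit `|α j⟩⟨β j|` at the site `j`. -/
def siteOp (j : ℤ) (α β : ℤ → ℕ) : LInf :=
  ⟨unitOp {j} α β, localOp_le j j (by rw [Finset.Icc_self]; exact ⟨_, rfl⟩)⟩

theorem incl_siteOp (j : ℤ) (α β : ℤ → ℕ) : LInf.incl (siteOp j α β) = unitOp {j} α β := rfl

theorem siteOp_mem_loc (j : ℤ) (α β : ℤ → ℕ) : siteOp j α β ∈ LInf.loc (Finset.Icc j j) := by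
  rw [Finset.Icc_self]; exact ⟨_, rfl⟩

theorem star_matUnit {α : Type} (s t : α) : star (matUnit s t) = matUnit t s := by
  rw [matUnit, ContinuousLinearMap.star_eq_adjoint, InnerProductSpace.adjoint_rankOne]; rfl

theorem span_ket_closed {α : Type} (K : Submodule ℂ (L2 α)) (hK : IsClosed (K : Set (L2 α)))
    (h : ∀ s, ket s ∈ K) : K = ⊤ := by
  have : CompleteSpace K := hK.completeSpace_coe
  rw [← Submodule.orthogonal_eq_bot_iff, eq_bot_iff]
  intro f hf
  refine lp.ext (funext fun s => ?_)
  rw [← inner_ket, (Submodule.mem_orthogonal K f).1 hf _ (h s)]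
  rfl

theorem continuous_rankOne_left {α : Type} (f : L2 α) :
    Continuous fun g : L2 α => InnerProductSpace.rankOne ℂ g f := by
  fun_prop

theorem continuous_embed (p q : ℤ) : Continuous (LInf.embed p q) :=
  AddMonoidHomClass.continuous_of_bound (LInf.embed p q) 1 fun S => by
    rw [one_mul]; exact NonUnitalStarAlgHom.norm_apply_le (LInf.embed p q) S

/-- A vector that commutes with the matrix units at the sites of an interval commutes with the
local algebra of this interval. -/
theorem loc_le_commStar {X : FGCorr LInf} {x : X} {p q : ℤ}
    (h : ∀ j ∈ Finset.Icc p q, ∀ α β, siteOp j α β ∈ commSub x) :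
    LInf.loc (Finset.Icc p q) ≤ commStar x := by
  classical
  -- Products of single-site matrix units give all matrix units of the interval (`hE`), and norm
  -- closedness gives the rank-one operators `|f⟩⟨e_t|` (`hR`). Norm limits reach only compact
  -- operators in this way, so a general `S` needs the separate argument with `δ`.
  have hU : ∀ F ⊆ Finset.Icc p q, ∀ α β, ∃ a ∈ commSub x, LInf.incl a = unitOp F α β := by
    intro F
    induction F using Finset.induction_on with
    | empty => exact fun _ α β => ⟨1, one_mem _, by rw [map_one, unitOp_empty]⟩
    | insert j F hj ih =>
      intro hF α β
      obtain ⟨a, ha, hae⟩ := ih (fun i hi => hF (Finset.mem_insert_of_mem hi)) α β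
      refine ⟨siteOp j α β * a, mul_mem (h j (hF (Finset.mem_insert_self _ _)) α β) ha, ?_⟩
      rw [map_mul, incl_siteOp, hae, ← unitOp_union (Finset.disjoint_singleton_left.2 hj)]
      rfl
  have hE : ∀ s t : Finset.Icc p q → ℕ, LInf.embed p q (matUnit s t) ∈ commSub x := by
    intro s t
    have hext : ∀ s : Finset.Icc p q → ℕ, ∃ α : ℤ → ℕ, s = fun i : Finset.Icc p q => α i :=
      fun s => ⟨fun i => if hi : i ∈ Finset.Icc p q then s ⟨i, hi⟩ else 0, funext fun i => by
        simp only [i.2, dite_true]⟩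
    obtain ⟨α, rfl⟩ := hext s
    obtain ⟨β, rfl⟩ := hext t
    obtain ⟨a, ha, hae⟩ := hU _ subset_rfl α β
    rwa [show LInf.embed p q (matUnit (fun i => α i) fun i => β i) = a from incl_injective hae.symm]
  have hR : ∀ (t : Finset.Icc p q → ℕ) (f : L2 (Finset.Icc p q → ℕ)),
      LInf.embed p q (InnerProductSpace.rankOne ℂ f (ket t)) ∈ commSub x := by
    intro t
    let K : Submodule ℂ (L2 (Finset.Icc p q → ℕ)) :=
      { carrier := {f | LInf.embed p q (InnerProductSpace.rankOne ℂ f (ket t)) ∈ commSub x}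
        zero_mem' := by simp
        add_mem' := fun {f g} hf hg => by
          change LInf.embed p q (InnerProductSpace.rankOne ℂ (f + g) (ket t)) ∈ commSub x
          rw [map_add, add_apply, map_add]
          exact add_mem hf hg
        smul_mem' := fun z f hf => by
          change LInf.embed p q (InnerProductSpace.rankOne ℂ (z • f) (ket t)) ∈ commSub x
          rw [map_smul, smul_apply, map_smul]
          exact Subalgebra.smul_mem _ hf z }
    have hK : IsClosed (K : Set (L2 (Finset.Icc p q → ℕ))) :=
      (isClosed_commSub x).preimage ((continuous_embed p q).comp (continuous_rankOne_left _))
    exact fun f => Submodule.eq_top_iff'.1 (span_ket_closed K hK fun s => hE s t) f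
  refine le_commStar fun a ha => ?_
  obtain ⟨S, rfl⟩ := mem_loc_iff.1 ha
  set a := LInf.embed p q S
  rw [mem_commSub, ← sub_eq_zero]
  -- For `e = |e_s⟩⟨e_s|` the product `a e` has rank one and commutes with `x`, whence `δ e = a e x
  -- - x a e = 0`. So `⟨δ, δ⟩` is annihilated by all these projections, and they sum strongly to
  -- `1`.
  set δ := X.lact a x - X.ract (op a) x with hδ
  have hδe : ∀ s, X.ract (op (LInf.embed p q (matUnit s s))) δ = 0 := by
    intro s
    set e := LInf.embed p q (matUnit s s)
    have h1 : a * e ∈ commSub x := by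
      have : a * e = LInf.embed p q (InnerProductSpace.rankOne ℂ (S (ket s)) (ket s)) := by
        rw [← map_mul]
        congr 1
        exact ContinuousLinearMap.ext fun f => by simp [matUnit]
      rw [this]
      exact hR s _
    rw [hδ, map_sub, ← X.lact_ract, ← mem_commSub.1 (hE s s), ← X.lact_mul_apply,
      ← X.ract_mul_apply, mem_commSub.1 h1, sub_self]
  apply X.inner_self_eq_zero
  apply incl_injective
  rw [map_zero]
  have hT : ∀ s, ampl (splitConfig (Finset.Icc p q)) (matUnit s s) *
      LInf.incl (X.inner δ δ) = 0 := by
    intro s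
    have h1 : X.inner δ δ * LInf.embed p q (matUnit s s) = 0 := by
      rw [← X.inner_ract, hδe, map_zero]
    have h2 := congrArg star h1
    rw [star_mul, star_zero, X.star_inner, ← map_star, star_matUnit] at h2
    have h3 := congrArg LInf.incl h2
    rwa [map_mul, map_zero] at h3
  refine ContinuousLinearMap.ext fun ξ => lp.ext (funext fun c => ?_)
  -- The projection onto the restriction of `c` to the interval does not change the coefficient at
  -- `c`.
  have h4 := congrArg (fun T : L2 Config →L[ℂ] L2 Config => T ξ c) (hT fun i => c i)
  simp only [mul_apply_eq_comp] at h4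
  have h5 := unitOp_apply (Finset.Icc p q) c c (LInf.incl (X.inner δ δ) ξ) c
  rw [if_pos (fun _ _ => rfl), unitOp, h4] at h5
  rw [show upd (Finset.Icc p q) c c = c from Finsupp.ext fun i => by rw [upd_apply]; simp] at h5
  exact h5.symm

theorem commute_siteOp {i j : ℤ} (h : i ≠ j) (α β α' β') :
    siteOp i α β * siteOp j α' β' = siteOp j α' β' * siteOp i α β :=
  incl_injective (commute_unitOp (Finset.disjoint_singleton.2 h) α β α' β')

/-- Locality. -/
theorem commute_of_mem_loc {p q r s : ℤ} (h : Disjoint (Finset.Icc p q) (Finset.Icc r s))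
    {a b : LInf} (ha : a ∈ LInf.loc (Finset.Icc p q)) (hb : b ∈ LInf.loc (Finset.Icc r s)) :
    a * b = b * a := by
  -- `loc_le_commStar` is applied twice to the trivial bimodule: with a matrix unit of the second
  -- interval as the vector, and then with `a` as the vector. This reduces locality to matrix units
  -- at distinct sites.
  have h1 : ∀ j ∈ Finset.Icc r s, ∀ α β, siteOp j α β * a = a * siteOp j α β := by
    intro j hj α β
    have := loc_le_commStar (X := unit LInf) (x := toUnit (siteOp j α β)) (p := p) (q := q)
      (fun i hi α' β' => mem_commSub_unit.2 (commute_siteOp (by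
        rintro rfl; exact Finset.disjoint_left.1 h hi hj) _ _ _ _)) ha
    exact (mem_commSub_unit.1 this.1).symm
  have h2 := loc_le_commStar (X := unit LInf) (x := toUnit a) (p := r) (q := s)
    (fun j hj α β => mem_commSub_unit.2 (h1 j hj α β)) hb
  exact (mem_commSub_unit.1 h2.1).symm

theorem complAlg_commute {p q : ℤ} {a b : LInf} (ha : a ∈ LInf.loc (Finset.Icc p q))
    (hb : b ∈ complAlg LInf.loc (Finset.Icc p q)) : b * a = a * b := by
  have : IsLocalized LInf.loc (Finset.Icc p q) (X := unit LInf) (toUnit a) :=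
    isLocalized_of_le fun r s hrs => le_commStar fun c hc =>
      mem_commSub_unit.2 (commute_of_mem_loc hrs hc ha)
  exact mem_commSub_unit.1 (this b hb)

theorem loc_le_complAlg {p q : ℤ} {I : Finset ℤ} (h : Disjoint (Finset.Icc p q) I) :
    LInf.loc (Finset.Icc p q) ≤ complAlg LInf.loc I :=
  (le_iSup₂_of_le (f := fun p q => ⨆ (_ : Disjoint (Finset.Icc p q) I), LInf.loc (Finset.Icc p q))
    p q (le_iSup (fun _ => LInf.loc (Finset.Icc p q)) h)).trans
    (StarSubalgebra.le_topologicalClosure _)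

theorem siteOp_mem_complAlg {j : ℤ} {I : Finset ℤ} (h : j ∉ I) (α β) :
    siteOp j α β ∈ complAlg LInf.loc I :=
  loc_le_complAlg (by rwa [Finset.Icc_self, Finset.disjoint_singleton_left]) (siteOp_mem_loc j α β)

/-- Haag duality. -/
theorem mem_loc_of_commute {I : Finset ℤ} {a : LInf}
    (h : ∀ b ∈ complAlg LInf.loc I, a * b = b * a) : a ∈ LInf.loc I :=
  mem_localOp_of_commute I (LInf.incl a) fun _ hj α β =>
    congrArg LInf.incl (h _ (siteOp_mem_complAlg hj α β))

/-- By locality the matrix unit commutes with the algebra of the complement, so Haag duality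
applies. -/
theorem siteOp_mem_loc_of_mem {j p q : ℤ} (h : j ∈ Finset.Icc p q) (α β) :
    siteOp j α β ∈ LInf.loc (Finset.Icc p q) := by
  have : IsLocalized LInf.loc (Finset.Icc p q) (X := unit LInf) (toUnit (siteOp j α β)) :=
    isLocalized_of_le fun r s hrs => le_commStar fun c hc =>
      mem_commSub_unit.2 (commute_of_mem_loc (by
        rw [Finset.Icc_self, Finset.disjoint_singleton_right]
        exact Finset.disjoint_right.1 hrs h) hc (siteOp_mem_loc j α β))
  exact mem_loc_of_commute fun b hb => (mem_commSub_unit.1 (this b hb)).symm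

/-- The local algebras generate a dense subalgebra, and the commutant of a vector is closed. -/
theorem mem_commSub_of_loc {X : FGCorr LInf} {x : X}
    (h : ∀ p q, LInf.loc (Finset.Icc p q) ≤ commStar x) (a : LInf) : a ∈ commSub x := by
  -- `quasiLocal` is a closure inside `B(ℓ²(Config))`; the closed embedding makes the image of the
  -- commutant closed there.
  have hemb : Topology.IsClosedEmbedding LInf.incl := isClosed_quasiLocal.isClosedEmbedding_subtypeVal
  have hle : quasiLocal ≤ (commStar x).map LInf.incl := by
    refine StarSubalgebra.topologicalClosure_minimal (iSup_le fun p => iSup_le fun q => ?_)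
      (hemb.isClosedMap _ (isClosed_commStar x))
    rintro T hT
    exact ⟨⟨T, localOp_le p q hT⟩, h p q hT, rfl⟩
  obtain ⟨b, hb, hba⟩ := hle a.2
  rw [← show b = a from incl_injective hba]
  exact hb.1

/-- A vector localized in an interval that commutes with the local algebra is central. -/
theorem mem_commSub_of_isLocalized {X : FGCorr LInf} {x : X} {p q : ℤ}
    (hx : IsLocalized LInf.loc (Finset.Icc p q) x)
    (h : ∀ a ∈ LInf.loc (Finset.Icc p q), a ∈ commSub x) (a : LInf) : a ∈ commSub x := by
  refine mem_commSub_of_loc (fun r s => loc_le_commStar fun j _ α β => ?_) a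
  by_cases hj : j ∈ Finset.Icc p q
  · exact h _ (siteOp_mem_loc_of_mem hj α β)
  · exact hx _ (siteOp_mem_complAlg hj α β)

/-- The inner product commutes with the algebra of the complement by `commute_inner`, so Haag
duality applies. -/
theorem inner_mem_loc {X : FGCorr LInf} {x y : X} {p q : ℤ}
    (hx : IsLocalized LInf.loc (Finset.Icc p q) x) (hy : IsLocalized LInf.loc (Finset.Icc p q) y) :
    X.inner x y ∈ LInf.loc (Finset.Icc p q) :=
  mem_loc_of_commute fun b hb => commute_inner (hx _ (star_mem hb)) (hy b hb)

/-- The vacuum state. -/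
def vac : LInf →ₗ[ℂ] ℂ where
  toFun a := ⟪ket 0, LInf.incl a (ket 0)⟫_ℂ
  map_add' a b := by simp
  map_smul' z a := by simp

theorem vac_one : vac 1 = 1 := by
  classical
  change ⟪ket 0, LInf.incl 1 (ket 0)⟫_ℂ = 1
  rw [map_one, one_apply_eq_self, inner_ket, ket_apply, if_pos rfl]

theorem vac_star (a : LInf) : vac (star a) = star (vac a) := by
  change ⟪ket 0, LInf.incl (star a) (ket 0)⟫_ℂ = starRingEnd ℂ ⟪ket 0, LInf.incl a (ket 0)⟫_ℂ
  rw [map_star, inner_conj_symm, ContinuousLinearMap.star_eq_adjoint,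
    ContinuousLinearMap.adjoint_inner_right]

/-- The center of `L^∞` is trivial. -/
theorem eq_vac_of_central {a : LInf} (h : ∀ b, a * b = b * a) : a = vac a • 1 := by
  -- Haag duality is used for the empty interval `Icc 1 0`, whose local algebra acts on the
  -- one-dimensional space over the single empty configuration.
  obtain ⟨S, rfl⟩ := mem_loc_iff.1 (mem_loc_of_commute (I := Finset.Icc 1 0) fun b _ => h b)
  have : IsEmpty (Finset.Icc (1 : ℤ) 0) := ⟨fun i => by simpa using i.2⟩
  have hS : S = S (ket isEmptyElim) isEmptyElim • 1 := clm_ext_ket fun s t => by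
    classical
    rw [Subsingleton.elim s isEmptyElim, Subsingleton.elim t isEmptyElim]
    simp [ket_apply]
  rw [hS, map_smul, map_one, map_smul, vac_one]
  simp

end LInfLemmas

/-! ### Almost disjoint families and the isometries that they define -/

section AlmostDisjoint

/-- Uncountably many injections with almost disjoint ranges. -/
theorem exists_almost_disjoint (S : Type) [Countable S] [Infinite S] :
    ∃ f : (ℕ → Bool) → S → S, (∀ x, Function.Injective (f x)) ∧
      ∀ x y, x ≠ y → {p : S × S | f x p.1 = f y p.2}.Finite := by
  obtain ⟨e⟩ : Nonempty (S ≃ ℕ) := nonempty_equiv_of_countable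
  obtain ⟨g, hg⟩ := exists_injective_nat (Σ n : ℕ, (Fin n → Bool))
  -- The `n`-th element goes to a code of the initial segment of length `n` of the binary sequence
  -- `x`.
  refine ⟨fun x s => e.symm (g ⟨e s, fun i => x i⟩), fun x s t h => ?_, fun x y hxy => ?_⟩
  · exact e.injective (congrArg Sigma.fst (hg (e.symm.injective h)))
  · obtain ⟨k, hk⟩ := Function.ne_iff.1 hxy
    -- Sequences that differ at `k` share no initial segment of length greater than `k`.
    refine ((Set.finite_Iic k).image fun n => (e.symm n, e.symm n)).subset ?_
    rintro ⟨s, t⟩ h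
    have h1 := hg (e.symm.injective h)
    have h2 : e s = e t := congrArg Sigma.fst h1
    have hst : s = t := e.injective h2
    subst hst
    have h3 := eq_of_heq (Sigma.mk.inj h1).2
    refine ⟨e s, ?_, by simp⟩
    by_contra hlt
    exact hk (congrFun h3 ⟨k, not_le.1 hlt⟩)

variable {S : Type}

theorem orthonormal_ket : Orthonormal ℂ (ket : S → L2 S) := by
  classical
  rw [orthonormal_iff_ite]
  intro s t
  rw [inner_ket, ket_apply]

/-- The isometry `e_s ↦ e_{f s}`. -/
def shift (f : S → S) (hf : Function.Injective f) : L2 S →L[ℂ] L2 S :=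
  ((orthonormal_ket.comp f hf).orthogonalFamily.linearIsometry).toContinuousLinearMap

theorem shift_ket (f : S → S) (hf : Function.Injective f) (s : S) :
    shift f hf (ket s) = ket (f s) := by
  classical
  have := (orthonormal_ket.comp f hf).orthogonalFamily.linearIsometry_apply_single
    (i := s) (1 : ℂ)
  rw [LinearIsometry.toSpanSingleton_apply, one_smul] at this
  rw [← Function.comp_apply (f := ket) (g := f), ← this, ket]
  rfl

open Classical in
theorem star_shift_mul_shift_ket (f g : S → S) (hf : Function.Injective f)
    (hg : Function.Injective g) (s t : S) :
    (star (shift f hf) * shift g hg) (ket s) t = if f t = g s then 1 else 0 := by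
  rw [mul_apply_eq_comp, ← inner_ket, ContinuousLinearMap.star_eq_adjoint,
    ContinuousLinearMap.adjoint_inner_right, shift_ket, shift_ket, inner_ket, ket_apply]

theorem star_shift_mul_self (f : S → S) (hf : Function.Injective f) :
    star (shift f hf) * shift f hf = 1 := by
  classical
  refine clm_ext_ket fun s t => ?_
  rw [star_shift_mul_shift_ket, one_apply_eq_self, ket_apply]
  exact if_congr hf.eq_iff rfl rfl

/-- Almost disjoint ranges make this product a finite sum of matrix units, which vanishes on any
vector that the matrix units annihilate. -/
theorem star_shift_mul_shift (f g : S → S) (hf : Function.Injective f)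
    (hg : Function.Injective g) (h : {p : S × S | f p.1 = g p.2}.Finite) :
    star (shift f hf) * shift g hg = ∑ p ∈ h.toFinset, matUnit p.1 p.2 := by
  classical
  refine clm_ext_ket fun s t => ?_
  rw [star_shift_mul_shift_ket, sum_apply, lp.coeFn_sum, Finset.sum_apply]
  have : ∀ p : S × S, (matUnit p.1 p.2 (ket s) : L2 S) t = if p = (t, s) then 1 else 0 := by
    rintro ⟨a, b⟩
    rw [matUnit_apply, lp.coeFn_smul, Pi.smul_apply, ket_apply, ket_apply]
    simp only [smul_eq_mul, ← ite_and, Prod.mk.injEq, mul_ite, mul_one, mul_zero]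
    exact if_congr ⟨fun h => ⟨h.1.symm, h.2⟩, fun h => ⟨h.1.symm, h.2⟩⟩ rfl rfl
  simp only [this]
  rw [Finset.sum_ite_eq']
  simp

theorem separableSpace_L2 (S : Type) [Countable S] :
    TopologicalSpace.SeparableSpace (L2 S) := by
  rw [← TopologicalSpace.isSeparable_univ_iff]
  have h := ((Set.countable_range (ket : S → L2 S)).isSeparable.span (R := ℂ)).closure
  have h2 := span_ket_closed (Submodule.span ℂ (Set.range (ket : S → L2 S))).topologicalClosure
    (Submodule.isClosed_topologicalClosure _)
    fun s => Submodule.le_topologicalClosure _ (Submodule.subset_span ⟨s, rfl⟩)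
  have h3 : closure (Submodule.span ℂ (Set.range (ket : S → L2 S)) : Set (L2 S)) = Set.univ := by
    rw [← Submodule.topologicalClosure_coe, h2, Submodule.top_coe]
  rwa [h3] at h

end AlmostDisjoint

/-! ### Representations of `B(ℓ²(S))` on separable Hilbert spaces -/

section Rep

open InnerProductSpace (rankOne)

variable {S E : Type} [NormedAddCommGroup E] [InnerProductSpace ℂ E]
  {π : (L2 S →L[ℂ] L2 S) →ₗ[ℂ] Module.End ℂ E}

/-- Representations of `B(ℓ²(S))` on a separable Hilbert space are normal. -/
theorem rep_normal [Countable S] [Infinite S] [TopologicalSpace.SeparableSpace E]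
    (hmul : ∀ a b, π (a * b) = π a * π b)
    (hadj : ∀ a u v, ⟪π a u, v⟫_ℂ = ⟪u, π (star a) v⟫_ℂ) {u : E}
    (hu : ∀ s t, π (matUnit s t) u = 0) : π 1 u = 0 := by
  by_contra hne
  obtain ⟨f, hf, hd⟩ := exists_almost_disjoint S
  -- The vectors `w x` are pairwise orthogonal, as `u` is killed by matrix units, and all have the
  -- norm of `π 1 u`, as the shifts are isometries. Balls around them are then uncountably many
  -- disjoint open sets, against separability.
  let w : (ℕ → Bool) → E := fun x => π (shift (f x) (hf x)) u
  have hw : ∀ x y, ⟪w x, w y⟫_ℂ =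
      ⟪u, π (star (shift (f x) (hf x)) * shift (f y) (hf y)) u⟫_ℂ := fun x y => by
    rw [hadj, hmul]; rfl
  have horth : ∀ x y, x ≠ y → ⟪w x, w y⟫_ℂ = 0 := by
    intro x y hxy
    rw [hw, star_shift_mul_shift _ _ _ _ (hd x y hxy), map_sum, LinearMap.sum_apply,
      Finset.sum_eq_zero fun p _ => hu p.1 p.2, inner_zero_right]
  have hnorm : ∀ x, ‖w x‖ = ‖π 1 u‖ := by
    intro x
    have h1 : ⟪w x, w x⟫_ℂ = ⟪π 1 u, π 1 u⟫_ℂ := by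
      rw [hw, star_shift_mul_self, hadj, star_one, ← Module.End.mul_apply, ← hmul, one_mul]
    rw [inner_self_eq_norm_sq_to_K, inner_self_eq_norm_sq_to_K] at h1
    have h2 : ‖w x‖ ^ 2 = ‖π 1 u‖ ^ 2 := by
      have := congrArg Complex.re h1
      simpa [← Complex.ofReal_pow] using this
    exact (sq_eq_sq₀ (norm_nonneg _) (norm_nonneg _)).1 h2
  have hpos : 0 < ‖π 1 u‖ := norm_pos_iff.2 hne
  have hdist : ∀ x y, x ≠ y → ‖π 1 u‖ ≤ dist (w x) (w y) := by
    intro x y hxy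
    have h1 : ‖w x - w y‖ ^ 2 = ‖w x‖ ^ 2 + ‖w y‖ ^ 2 := by
      rw [@norm_sub_sq ℂ, horth x y hxy]; simp
    rw [hnorm, hnorm] at h1
    rw [dist_eq_norm]
    nlinarith [norm_nonneg (w x - w y)]
  have hcount : Countable (ℕ → Bool) :=
    Pairwise.countable_of_isOpen_disjoint (s := fun x => Metric.ball (w x) (‖π 1 u‖ / 2))
      (fun x y hxy => Metric.ball_disjoint_ball (by linarith [hdist x y hxy]))
      (fun x => Metric.isOpen_ball) (fun x => ⟨w x, Metric.mem_ball_self (by positivity)⟩)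
  -- Cantor's diagonal argument.
  obtain ⟨g, hg⟩ := exists_surjective_nat (ℕ → Bool)
  obtain ⟨n, hn⟩ := hg fun n => !g n n
  simpa using congrFun hn n

/-- `|o⟩⟨h| |k⟩⟨o| = ⟨h, k⟩ |o⟩⟨o|`, and `π(|o⟩⟨o|)` fixes `w`. For `v = w` this bounds the
intertwiner of `v`; for orthonormal vectors it says that the intertwiners are isometries with
orthogonal ranges. -/
theorem rep_inner (hmul : ∀ a b, π (a * b) = π a * π b)
    (hadj : ∀ a u v, ⟪π a u, v⟫_ℂ = ⟪u, π (star a) v⟫_ℂ) (o h k : L2 S) {v w : E}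
    (hw : π (rankOne ℂ o o) w = w) :
    ⟪π (rankOne ℂ h o) v, π (rankOne ℂ k o) w⟫_ℂ = ⟪h, k⟫_ℂ * ⟪v, w⟫_ℂ := by
  rw [hadj, ContinuousLinearMap.star_eq_adjoint, InnerProductSpace.adjoint_rankOne,
    ← Module.End.mul_apply, ← hmul]
  have : rankOne ℂ o h * rankOne ℂ k o = ⟪h, k⟫_ℂ • rankOne ℂ o o :=
    InnerProductSpace.rankOne_comp_rankOne o h k o
  rw [this, map_smul, LinearMap.smul_apply, hw, inner_smul_right]

/-- The intertwiner `h ↦ π(|h⟩⟨o|) v`. -/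
def intertwiner (hmul : ∀ a b, π (a * b) = π a * π b)
    (hadj : ∀ a u v, ⟪π a u, v⟫_ℂ = ⟪u, π (star a) v⟫_ℂ) (o : L2 S) {v : E}
    (hv : π (rankOne ℂ o o) v = v) : L2 S →L[ℂ] E :=
  LinearMap.mkContinuous
    { toFun := fun h => π (rankOne ℂ h o) v
      map_add' := fun h k => by rw [map_add, add_apply, map_add, LinearMap.add_apply]
      map_smul' := fun z h => by
        rw [map_smul, smul_apply, map_smul, LinearMap.smul_apply]; rfl } ‖v‖ fun h => by
    refine le_of_sq_le_sq (le_of_eq ?_) (by positivity)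
    have h1 := congrArg Complex.re (rep_inner hmul hadj o h h hv (v := v))
    rw [inner_self_eq_norm_sq_to_K, inner_self_eq_norm_sq_to_K, inner_self_eq_norm_sq_to_K] at h1
    change ‖π (rankOne ℂ h o) v‖ ^ 2 = _
    simp only [Complex.coe_algebraMap, ← Complex.ofReal_pow, ← Complex.ofReal_mul,
      Complex.ofReal_re] at h1
    rw [h1]; ring

variable (hmul : ∀ a b, π (a * b) = π a * π b)
  (hadj : ∀ a u v, ⟪π a u, v⟫_ℂ = ⟪u, π (star a) v⟫_ℂ) (o : L2 S)

theorem intertwiner_apply {v : E} (hv : π (rankOne ℂ o o) v = v) (h : L2 S) :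
    intertwiner hmul hadj o hv h = π (rankOne ℂ h o) v := rfl

theorem rep_intertwiner {v : E} (hv : π (rankOne ℂ o o) v = v) (a : L2 S →L[ℂ] L2 S) (h : L2 S) :
    π a (intertwiner hmul hadj o hv h) = intertwiner hmul hadj o hv (a h) := by
  rw [intertwiner_apply, intertwiner_apply, ← Module.End.mul_apply, ← hmul]
  congr 2
  exact InnerProductSpace.comp_rankOne h o a

theorem inner_intertwiner {v w : E} (hv : π (rankOne ℂ o o) v = v) (hw : π (rankOne ℂ o o) w = w)
    (h k : L2 S) :
    ⟪intertwiner hmul hadj o hv h, intertwiner hmul hadj o hw k⟫_ℂ = ⟪h, k⟫_ℂ * ⟪v, w⟫_ℂ :=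
  rep_inner hmul hadj o h k hw

/-- If `v` is an orthonormal basis of the range of `π(|o⟩⟨o|)`, then the intertwiners given by `v`
decompose the representation. -/
theorem rep_decomposition [Countable S] [Infinite S] [TopologicalSpace.SeparableSpace E]
    [CompleteSpace E] (ho : ‖o‖ = 1) {k : ℕ} {v : Fin k → E}
    (hv : ∀ n, π (rankOne ℂ o o) (v n) = v n)
    (hspan : ∀ u, π (rankOne ℂ o o) u = u → u = ∑ n, ⟪v n, u⟫_ℂ • v n) (u : E) :
    π 1 u = ∑ n, intertwiner hmul hadj o (hv n)
      (ContinuousLinearMap.adjoint (intertwiner hmul hadj o (hv n)) u) := by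
  have hoo : ∀ h k : L2 S, rankOne ℂ h o * rankOne ℂ o k = rankOne ℂ h k := fun h k => by
    have := InnerProductSpace.rankOne_comp_rankOne (𝕜 := ℂ) h o o k
    rw [inner_self_eq_norm_sq_to_K, ho] at this
    simpa [ContinuousLinearMap.mul_def] using this
  rw [← sub_eq_zero]
  -- `π` need not be unital, so `π 1 u` is what gets decomposed. The remainder `w` is fixed by `π
  -- 1`; by `rep_normal` it vanishes once all matrix units kill it.
  set w := π 1 u - ∑ n, intertwiner hmul hadj o (hv n)
      (ContinuousLinearMap.adjoint (intertwiner hmul hadj o (hv n)) u) with hw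
  have h1 : π 1 w = w := by
    rw [hw, map_sub, ← Module.End.mul_apply, ← hmul, one_mul, map_sum]
    simp only [rep_intertwiner, one_apply_eq_self]
  rw [← h1]
  refine rep_normal hmul hadj fun s t => ?_
  rw [hw, map_sub, ← Module.End.mul_apply, ← hmul, mul_one, map_sum, sub_eq_zero]
  simp only [rep_intertwiner]
  -- `|e_s⟩⟨e_t|` factors through `o`, and `π(|o⟩⟨e_t|) u` lies in the range of `π(|o⟩⟨o|)`, where
  -- it can be expanded in the `v n`.
  have h2 := hspan (π (rankOne ℂ o (ket t)) u) (by
    rw [← Module.End.mul_apply, ← hmul, hoo])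
  have h3 : π (matUnit s t) u = π (rankOne ℂ (ket s) o) (π (rankOne ℂ o (ket t)) u) := by
    rw [← Module.End.mul_apply, ← hmul, hoo]; rfl
  rw [h3, h2, map_sum]
  refine Finset.sum_congr rfl fun n _ => ?_
  rw [map_smul, matUnit, InnerProductSpace.rankOne_apply, map_smul, intertwiner_apply,
    ContinuousLinearMap.adjoint_inner_right, intertwiner_apply, hadj,
    ContinuousLinearMap.star_eq_adjoint, InnerProductSpace.adjoint_rankOne]

end Rep

/-! ### Dualizability bounds the number of orthonormal central vectors -/

namespace FGCorr
section Central
variable {A : Type} [CStarAlgebra A] [PartialOrder A] [StarOrderedRing A] {X Y : FGCorr A}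

/-- Orthonormal families of central vectors. -/
structure IsCentralOrthonormal {k : ℕ} (ξ : Fin k → X) : Prop where
  central : ∀ n a, a ∈ commSub (ξ n)
  inner_eq : ∀ m n, X.inner (ξ m) (ξ n) = if m = n then 1 else 0

theorem lin_eq_inner_dag (f : X ⟶ unit A) (x : X) :
    Hom.lin f x = X.inner (Hom.lin (dag f) (toUnit 1)) x := by
  have h := inner_dag f x (toUnit 1)
  rw [← X.star_inner, ← h]
  have key : ∀ c : A, c = star (star c * 1) := fun c => by rw [mul_one, star_star]
  exact key _

/-- The map `y ↦ ε (y ⊗ ξ)` for a central vector `ξ`. -/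
def evalAt (ε : tensor Y X ⟶ unit A) (ξ : X) (hξ : ∀ a, a ∈ commSub ξ) : Y ⟶ unit A :=
  mkHom { toFun := fun y => Hom.lin ε (tens y ξ)
          map_add' := fun y y' => by rw [add_tens, map_add]
          map_smul' := fun z y => by rw [smul_tens, map_smul]; rfl }
    (fun a y => by
      change Hom.lin ε (tens (Y.lact a y) ξ) = _
      rw [← lact_tens, lin_lact]; rfl)
    (fun a y => by
      change Hom.lin ε (tens (Y.ract (op a.unop) y) ξ) = _
      rw [ract_tens, mem_commSub.1 (hξ _), ← ract_tens', lin_ract]; rfl)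

/-- A dualizable correspondence has only finitely many orthonormal central vectors. -/
theorem card_le_of_dual [Nontrivial A] (η : unit A ⟶ tensor X Y) (ε : tensor Y X ⟶ unit A)
    (hz : tensorMap η (𝟙 X) ≫ (assoc X Y X).hom ≫ tensorMap (𝟙 X) ε =
      (leftUnit X).hom ≫ (rightUnit X).inv)
    {N : ℕ} {ξ : Fin N → X} (hξ : IsCentralOrthonormal ξ) :
    (2 * N : ℝ) ≤
      ‖(tensor X Y).inner (Hom.lin η (toUnit 1)) (Hom.lin η (toUnit 1)) +
        (tensor Y X).inner (Hom.lin (dag ε) (toUnit 1)) (Hom.lin (dag ε) (toUnit 1))‖ := by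
  set R := Hom.lin η (toUnit 1) with hR
  set e := Hom.lin (dag ε) (toUnit 1) with he
  -- As `ξ n` is central, `ε (· ⊗ ξ n)` is a bimodule map; `v n` is the vector of `Y` that
  -- represents it and plays the role of the conjugate of `ξ n`.
  let f : Fin N → (Y ⟶ unit A) := fun n => evalAt ε (ξ n) (hξ.central n)
  let v : Fin N → Y := fun n => Hom.lin (dag (f n)) (toUnit 1)
  have hv : ∀ n y, Y.inner (v n) y = Hom.lin ε (tens y (ξ n)) := fun n y =>
    (lin_eq_inner_dag (f n) y).symm
  -- Pairing with `ξ n ⊗ v n` is one side of the zigzag identity applied to `t ⊗ ξ n`. For `t = R`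
  -- the identity returns `⟨ξ n, ξ n⟩ = 1`.
  have hcontr : ∀ n t, (tensor X Y).inner (tens (ξ n) (v n)) t = X.inner (ξ n)
      (Hom.lin (rightUnit X).hom (Hom.lin (tensorMap (𝟙 X) ε)
        (Hom.lin (assoc X Y X).hom (tens t (ξ n))))) := by
    intro n t
    induction t using tens_induction with
    | h1 x y =>
      rw [inner_tens, hv, ← lact_tens, lin_lact, assoc_hom_tens, tensorMap_tens]
      exact (X.inner_ract _ _ _).symm
    | h2 t t' h h' => simp only [map_add, add_tens, h, h']
  have hwR : ∀ n, (tensor X Y).inner (tens (ξ n) (v n)) R = 1 := by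
    intro n
    have h1 := congrArg (fun g => Hom.lin g (tens (toUnit 1) (ξ n))) hz
    simp only [lin_comp, tensorMap_tens, lin_id] at h1
    rw [hcontr, hR, h1, ← lin_comp, Iso.inv_hom_id, lin_id, leftUnit_hom_tens, map_one]
    change X.inner (ξ n) (ξ n) = 1
    rw [hξ.inner_eq, if_pos rfl]
  -- The vectors `w` and `z` have the same square `D`, while `⟨w, R⟩ = N` and `⟨e, z⟩ = D`.
  set w : tensor X Y := ∑ n, tens (ξ n) (v n) with hw
  set z : tensor Y X := ∑ n, tens (v n) (ξ n) with hzz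
  set D : A := ∑ n, Y.inner (v n) (v n) with hD
  have hDs : star D = D := by rw [hD, star_sum]; simp only [Y.star_inner]
  have hw' : ∀ t, (tensor X Y).inner w t = ∑ n, (tensor X Y).inner (tens (ξ n) (v n)) t := fun t => by
    rw [hw, map_sum, LinearMap.sum_apply]
  have hz' : ∀ t, (tensor Y X).inner z t = ∑ n, (tensor Y X).inner (tens (v n) (ξ n)) t := fun t => by
    rw [hzz, map_sum, LinearMap.sum_apply]
  have h1 : (tensor X Y).inner w R = (N : A) := by
    rw [hw', Finset.sum_congr rfl fun n _ => hwR n]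
    simp
  have h2 : (tensor X Y).inner w w = D := by
    rw [hw']
    refine Finset.sum_congr rfl fun m _ => ?_
    rw [hw, map_sum, Finset.sum_eq_single m]
    · rw [inner_tens, hξ.inner_eq, if_pos rfl, map_one]; rfl
    · intro n _ hnm
      rw [inner_tens, hξ.inner_eq, if_neg hnm.symm, map_zero, LinearMap.zero_apply, map_zero]
    · simp
  have h3 : (tensor Y X).inner z z = D := by
    rw [hz']
    refine Finset.sum_congr rfl fun m _ => ?_
    rw [hzz, map_sum, Finset.sum_eq_single m]
    · rw [inner_tens, mem_commSub.1 (hξ.central _ _), X.inner_ract, hξ.inner_eq, if_pos rfl, one_mul]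
    · intro n _ hnm
      rw [inner_tens, mem_commSub.1 (hξ.central _ _), X.inner_ract, hξ.inner_eq, if_neg hnm.symm,
        zero_mul]
    · simp
  have h4 : (tensor Y X).inner e z = D := by
    rw [← lin_eq_inner_dag, hzz, map_sum]
    exact Finset.sum_congr rfl fun n _ => (hv n _).symm
  have h5 : (tensor Y X).inner z e = D := by rw [← (tensor Y X).star_inner, h4, hDs]
  have h6 : (tensor X Y).inner R w = (N : A) := by
    rw [← (tensor X Y).star_inner, h1, star_natCast]
  have h7 := (tensor Y X).inner_self_nonneg (e - z)
  have h8 := (tensor X Y).inner_self_nonneg (R - w)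
  simp only [map_sub, LinearMap.sub_apply, h1, h2, h3, h4, h5, h6] at h7 h8
  -- In `⟨R - w, R - w⟩ + ⟨e - z, e - z⟩ ≥ 0` the unknown `D` cancels: its total coefficient is `1 +
  -- (1 - 2)`.
  have h9 : ((2 * N : ℕ) : A) ≤ (tensor X Y).inner R R + (tensor Y X).inner e e := by
    rw [← sub_nonneg]
    refine (add_nonneg h7 h8).trans (le_of_eq ?_)
    push_cast
    rw [two_mul]
    abel
  have h10 := CStarAlgebra.norm_le_norm_of_nonneg_of_le
    (by rw [← nsmul_one]; exact nsmul_nonneg zero_le_one _) h9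
  refine le_trans (le_of_eq ?_) h10
  have : ((2 * N : ℕ) : A) = ((2 * N : ℕ) : ℂ) • (1 : A) := by
    rw [← Algebra.algebraMap_eq_smul_one, map_natCast]
  rw [this, norm_smul, CStarRing.norm_one, mul_one, Complex.norm_natCast]
  push_cast; ring

theorem eq_of_inner_basis {n : ℕ} {b : Fin n → X} (hb : IsProjBasis X.ract X.inner b) {x y : X}
    (h : ∀ i, X.inner (b i) x = X.inner (b i) y) : x = y := by
  rw [hb x, hb y]
  simp only [h]

theorem inner_eq_sum {n : ℕ} {b : Fin n → X} (hb : IsProjBasis X.ract X.inner b) (x y : X) :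
    X.inner x y = ∑ i, star (X.inner (b i) x) * X.inner (b i) y := by
  conv_lhs => rw [hb y, map_sum]
  exact Finset.sum_congr rfl fun i _ => by rw [X.inner_ract, X.star_inner]

theorem inner_lact_eq_sum {n : ℕ} {b : Fin n → X} (hb : IsProjBasis X.ract X.inner b) (x y : X)
    (a : A) :
    X.inner x (X.lact a y) = ∑ i, X.inner x (X.lact a (b i)) * X.inner (b i) y := by
  conv_lhs => rw [hb y, map_sum, map_sum]
  exact Finset.sum_congr rfl fun i _ => by rw [X.lact_ract, X.inner_ract]

end Central
end FGCorr

open FGCorr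

instance : Nontrivial LInf := ⟨1, 0, fun h => by
  have := congrArg vac h
  rw [vac_one, map_zero] at this
  exact one_ne_zero this⟩

/-! ### From localized bases to central vectors -/

section Localized
variable {X : FGCorr LInf} {p q : ℤ}

theorem isLocalized_lact {x : X} (hx : IsLocalized LInf.loc (Finset.Icc p q) x) {a : LInf}
    (ha : a ∈ LInf.loc (Finset.Icc p q)) : IsLocalized LInf.loc (Finset.Icc p q) (X.lact a x) := by
  intro c hc
  rw [← X.lact_mul_apply, complAlg_commute ha hc, X.lact_mul_apply, hx c hc, X.lact_ract]

theorem isLocalized_ract {x : X} (hx : IsLocalized LInf.loc (Finset.Icc p q) x) {a : LInf}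
    (ha : a ∈ LInf.loc (Finset.Icc p q)) :
    IsLocalized LInf.loc (Finset.Icc p q) (X.ract (op a) x) := by
  intro c hc
  rw [X.lact_ract, hx c hc, ← X.ract_mul_apply, ← X.ract_mul_apply, complAlg_commute ha hc]

theorem isLocalized_sum {n : ℕ} {x : Fin n → X} {I : Finset ℤ}
    (hx : ∀ i, IsLocalized LInf.loc I (x i)) : IsLocalized LInf.loc I (∑ i, x i) := by
  intro c hc
  rw [map_sum, map_sum]
  exact Finset.sum_congr rfl fun i _ => hx i c hc

end Localized

section LocalRep

open InnerProductSpace (rankOne)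

variable {X : FGCorr LInf} {p q : ℤ} {n : ℕ} {b : Fin n → X}

theorem exists_coef (hl : ∀ i, IsLocalized LInf.loc (Finset.Icc p q) (b i)) (i j : Fin n)
    (a : L2 (Finset.Icc p q → ℕ) →L[ℂ] L2 (Finset.Icc p q → ℕ)) :
    ∃ M, LInf.embed p q M = X.inner (b i) (X.lact (LInf.embed p q a) (b j)) :=
  mem_loc_iff.1 (inner_mem_loc (hl i) (isLocalized_lact (hl j) (mem_loc_iff.2 ⟨a, rfl⟩)))

/-- The matrix coefficients `⟨b i, a (b j)⟩` of the left action of the local algebra. -/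
def coef (hl : ∀ i, IsLocalized LInf.loc (Finset.Icc p q) (b i)) (i j : Fin n)
    (a : L2 (Finset.Icc p q → ℕ) →L[ℂ] L2 (Finset.Icc p q → ℕ)) :
    L2 (Finset.Icc p q → ℕ) →L[ℂ] L2 (Finset.Icc p q → ℕ) := (exists_coef hl i j a).choose

variable (hl : ∀ i, IsLocalized LInf.loc (Finset.Icc p q) (b i))

theorem embed_coef (i j : Fin n) (a) : LInf.embed p q (coef hl i j a) =
    X.inner (b i) (X.lact (LInf.embed p q a) (b j)) := (exists_coef hl i j a).choose_spec

theorem coef_add (i j : Fin n) (a c) : coef hl i j (a + c) = coef hl i j a + coef hl i j c :=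
  embed_injective p q (by simp only [map_add, embed_coef, LinearMap.add_apply])

theorem coef_smul (i j : Fin n) (z : ℂ) (a) : coef hl i j (z • a) = z • coef hl i j a :=
  embed_injective p q (by simp only [map_smul, embed_coef, LinearMap.smul_apply])

/-- Insert the basis expansion `∑ b k ⟨b k, ·⟩ = 1` between `a` and `c`. -/
theorem coef_mul (hb : IsProjBasis X.ract X.inner b) (i j : Fin n) (a c) :
    coef hl i j (a * c) = ∑ k, coef hl i k a * coef hl k j c :=
  embed_injective p q (by
    simp only [map_sum, map_mul, embed_coef, Module.End.mul_apply]
    exact inner_lact_eq_sum hb _ _ _)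

theorem star_coef (i j : Fin n) (a) : star (coef hl i j a) = coef hl j i (star a) :=
  embed_injective p q (by
    rw [map_star, embed_coef, embed_coef, X.star_inner, X.inner_lact, map_star (LInf.embed p q)])

/-- The Hilbert space `ℓ²(ℕ)^{⊗I} ⊗ ℂⁿ`. -/
abbrev AmplSpace (p q : ℤ) (n : ℕ) : Type := PiLp 2 fun _ : Fin n => L2 (Finset.Icc p q → ℕ)

/-- The representation of the local algebra given by the left action. -/
def localRep : (L2 (Finset.Icc p q → ℕ) →L[ℂ] L2 (Finset.Icc p q → ℕ)) →ₗ[ℂ]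
    Module.End ℂ (AmplSpace p q n) where
  toFun a :=
    { toFun := fun v => WithLp.toLp 2 fun i => ∑ j, coef hl i j a (v j)
      map_add' := fun v w => by ext1 i; simp [Finset.sum_add_distrib]
      map_smul' := fun z v => by ext1 i; simp [Finset.smul_sum] }
  map_add' a c := by ext1 v; ext1 i; simp [coef_add, Finset.sum_add_distrib]
  map_smul' z a := by ext1 v; ext1 i; simp [coef_smul, Finset.smul_sum]

theorem localRep_apply (a) (v : AmplSpace p q n) (i : Fin n) :
    localRep hl a v i = ∑ j, coef hl i j a (v j) := rfl

theorem localRep_mul (hb : IsProjBasis X.ract X.inner b) (a c) :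
    localRep hl (a * c) = localRep hl a * localRep hl c := by
  ext1 v
  ext1 i
  simp only [localRep_apply, Module.End.mul_apply, coef_mul hl hb, sum_apply, map_sum,
    mul_apply_eq_comp]
  exact Finset.sum_comm

theorem localRep_adj (a) (u v : AmplSpace p q n) :
    ⟪localRep hl a u, v⟫_ℂ = ⟪u, localRep hl (star a) v⟫_ℂ := by
  simp only [PiLp.inner_apply, localRep_apply, sum_inner, inner_sum]
  rw [Finset.sum_comm]
  refine Finset.sum_congr rfl fun i _ => Finset.sum_congr rfl fun j _ => ?_
  rw [← star_coef, ContinuousLinearMap.star_eq_adjoint, ContinuousLinearMap.adjoint_inner_right]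

variable (hb : IsProjBasis X.ract X.inner b)

/-- The components of an intertwiner. -/
def intertwinerCoord (o : L2 (Finset.Icc p q → ℕ)) {v : AmplSpace p q n}
    (hv : localRep hl (rankOne ℂ o o) v = v) (i : Fin n) :
    L2 (Finset.Icc p q → ℕ) →L[ℂ] L2 (Finset.Icc p q → ℕ) :=
  (PiLp.proj 2 (fun _ : Fin n => L2 (Finset.Icc p q → ℕ)) i : _ →L[ℂ] _) ∘L
    intertwiner (localRep_mul hl hb) (localRep_adj hl) o hv

/-- The relation `π(a) V = V a` in components. It is what makes `∑ b i V_i` commute with the local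
algebra. -/
theorem coef_comp_intertwinerCoord (o : L2 (Finset.Icc p q → ℕ)) {v : AmplSpace p q n}
    (hv : localRep hl (rankOne ℂ o o) v = v) (i : Fin n) (a) :
    ∑ j, coef hl i j a * intertwinerCoord hl hb o hv j = intertwinerCoord hl hb o hv i * a := by
  ext1 h
  rw [sum_apply]
  exact congrArg (fun w : AmplSpace p q n => w i)
    (rep_intertwiner (localRep_mul hl hb) (localRep_adj hl) o hv a h)

/-- The central vector given by a vector `v` with `π(|o⟩⟨o|) v = v`. -/
def centralVec (o : L2 (Finset.Icc p q → ℕ)) {v : AmplSpace p q n}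
    (hv : localRep hl (rankOne ℂ o o) v = v) : X :=
  ∑ i, X.ract (op (LInf.embed p q (intertwinerCoord hl hb o hv i))) (b i)

theorem inner_lact_centralVec (o : L2 (Finset.Icc p q → ℕ)) {v : AmplSpace p q n}
    (hv : localRep hl (rankOne ℂ o o) v = v) (i : Fin n) (a) :
    X.inner (b i) (X.lact (LInf.embed p q a) (centralVec hl hb o hv)) =
      LInf.embed p q (intertwinerCoord hl hb o hv i * a) := by
  rw [← coef_comp_intertwinerCoord, centralVec, map_sum, map_sum, map_sum]
  refine Finset.sum_congr rfl fun j _ => ?_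
  rw [X.lact_ract, X.inner_ract, map_mul, embed_coef]

theorem inner_centralVec (o : L2 (Finset.Icc p q → ℕ)) {v : AmplSpace p q n}
    (hv : localRep hl (rankOne ℂ o o) v = v) (i : Fin n) :
    X.inner (b i) (centralVec hl hb o hv) = LInf.embed p q (intertwinerCoord hl hb o hv i) := by
  have h := inner_lact_centralVec hl hb o hv i 1
  rwa [map_one, map_one, mul_one] at h

/-- The vector commutes with the local algebra by the intertwining relation. It is localized in the
interval because the `b i` are and the `V_i` lie in the local algebra. -/
theorem centralVec_central (o : L2 (Finset.Icc p q → ℕ)) {v : AmplSpace p q n}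
    (hv : localRep hl (rankOne ℂ o o) v = v) (a : LInf) :
    a ∈ commSub (centralVec hl hb o hv) := by
  have hloc : IsLocalized LInf.loc (Finset.Icc p q) (centralVec hl hb o hv) :=
    isLocalized_sum fun i => isLocalized_ract (hl i) (mem_loc_iff.2 ⟨_, rfl⟩)
  refine mem_commSub_of_isLocalized hloc (fun c hc => ?_) a
  obtain ⟨S, rfl⟩ := mem_loc_iff.1 hc
  refine eq_of_inner_basis hb fun i => ?_
  rw [inner_lact_centralVec, X.inner_ract, inner_centralVec, map_mul]

/-- The inner product is `∑ (V_v)_i* (V_w)_i = V_v* V_w`, a scalar by `inner_intertwiner`.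
Orthonormal vectors of the multiplicity space thus give orthonormal central vectors. -/
theorem inner_centralVec_centralVec (o : L2 (Finset.Icc p q → ℕ)) {v w : AmplSpace p q n}
    (hv : localRep hl (rankOne ℂ o o) v = v) (hw : localRep hl (rankOne ℂ o o) w = w) :
    X.inner (centralVec hl hb o hv) (centralVec hl hb o hw) = ⟪v, w⟫_ℂ • 1 := by
  rw [inner_eq_sum hb]
  simp only [inner_centralVec, ← map_star, ← map_mul]
  rw [← map_sum, ← map_one (LInf.embed p q), ← map_smul]
  congr 1
  ext1 k
  refine ext_inner_left ℂ fun h => ?_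
  rw [sum_apply, inner_sum]
  have := inner_intertwiner (localRep_mul hl hb) (localRep_adj hl) o hv hw h k
  rw [PiLp.inner_apply] at this
  refine Eq.trans (Finset.sum_congr rfl fun i _ => ?_) (this.trans ?_)
  · rw [mul_apply_eq_comp, ContinuousLinearMap.star_eq_adjoint,
      ContinuousLinearMap.adjoint_inner_right]
    rfl
  · rw [smul_apply, inner_smul_right, one_apply_eq_self, mul_comm]

theorem adjoint_intertwiner_single (o : L2 (Finset.Icc p q → ℕ)) {v : AmplSpace p q n}
    (hv : localRep hl (rankOne ℂ o o) v = v) (j : Fin n) (h : L2 (Finset.Icc p q → ℕ)) :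
    ContinuousLinearMap.adjoint (intertwiner (localRep_mul hl hb) (localRep_adj hl) o hv)
      (PiLp.single 2 j h) = star (intertwinerCoord hl hb o hv j) h := by
  refine ext_inner_left ℂ fun g => ?_
  rw [ContinuousLinearMap.adjoint_inner_right, ContinuousLinearMap.star_eq_adjoint,
    ContinuousLinearMap.adjoint_inner_right, PiLp.inner_apply, Finset.sum_eq_single j]
  · rw [PiLp.single_apply, if_pos rfl]; rfl
  · intro k _ hk
    rw [PiLp.single_apply, if_neg hk, inner_zero_right]
  · simp

/-- The `(i, j)` entry of `π(1) = ∑ V_m V_m*`, obtained by applying both sides to a vector supported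
in the `j`-th summand. -/
theorem coef_one_eq_sum (o : L2 (Finset.Icc p q → ℕ)) {k : ℕ} {v : Fin k → AmplSpace p q n}
    (hv : ∀ m, localRep hl (rankOne ℂ o o) (v m) = v m)
    (hdec : ∀ u, localRep hl 1 u = ∑ m, intertwiner (localRep_mul hl hb) (localRep_adj hl) o (hv m)
      (ContinuousLinearMap.adjoint
        (intertwiner (localRep_mul hl hb) (localRep_adj hl) o (hv m)) u)) (i j : Fin n) :
    coef hl i j 1 =
      ∑ m, intertwinerCoord hl hb o (hv m) i * star (intertwinerCoord hl hb o (hv m) j) := by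
  ext1 h
  have h1 := congrArg (fun w : AmplSpace p q n => w i) (hdec (PiLp.single 2 j h))
  have h2 : (localRep hl 1 (PiLp.single 2 j h) : AmplSpace p q n) i = coef hl i j 1 h := by
    rw [localRep_apply, Finset.sum_eq_single j]
    · rw [PiLp.single_apply, if_pos rfl]
    · intro k _ hk
      rw [PiLp.single_apply, if_neg hk, map_zero]
    · simp
  rw [← h2, h1, WithLp.ofLp_sum, Finset.sum_apply, sum_apply]
  exact Finset.sum_congr rfl fun m _ => by rw [adjoint_intertwiner_single]; rfl

theorem isProjBasis_centralVec (hpq : p ≤ q) {o : L2 (Finset.Icc p q → ℕ)} (ho : ‖o‖ = 1)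
    {k : ℕ} {v : Fin k → AmplSpace p q n} (hv : ∀ m, localRep hl (rankOne ℂ o o) (v m) = v m)
    (hspan : ∀ u, localRep hl (rankOne ℂ o o) u = u → u = ∑ m, ⟪v m, u⟫_ℂ • v m) :
    IsProjBasis X.ract X.inner fun m => centralVec hl hb o (hv m) := by
  -- A nonempty interval has infinitely many configurations, as `rep_normal` requires.
  have : Nonempty (Finset.Icc p q) := ⟨⟨p, Finset.mem_Icc.2 ⟨le_rfl, hpq⟩⟩⟩
  have : TopologicalSpace.SeparableSpace (L2 (Finset.Icc p q → ℕ)) := separableSpace_L2 _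
  have : SecondCountableTopology (L2 (Finset.Icc p q → ℕ)) :=
    UniformSpace.secondCountable_of_separable _
  have hdec := rep_decomposition (localRep_mul hl hb) (localRep_adj hl) o ho hv hspan
  have hsum := coef_one_eq_sum hl hb o hv hdec
  -- Since `coef 1` is `⟨b i, b j⟩`, the formula for `π(1)` is this expansion paired with each `b
  -- i`.
  have hbj : ∀ j, b j = ∑ m, X.ract (op (X.inner (centralVec hl hb o (hv m)) (b j)))
      (centralVec hl hb o (hv m)) := by
    intro j
    refine eq_of_inner_basis hb fun i => ?_
    have h1 := embed_coef hl i j 1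
    rw [map_one, map_one] at h1
    change _ = X.inner (b i) (b j) at h1
    rw [← h1, hsum, map_sum, map_sum]
    refine Finset.sum_congr rfl fun m _ => ?_
    rw [X.inner_ract, inner_centralVec, ← X.star_inner (b j), inner_centralVec, map_mul, map_star]
  intro x
  conv_lhs => rw [hb x]
  have h3 : ∀ m, X.inner (centralVec hl hb o (hv m)) x =
      ∑ j, X.inner (centralVec hl hb o (hv m)) (b j) * X.inner (b j) x := fun m => by
    conv_lhs => rw [hb x, map_sum]
    exact Finset.sum_congr rfl fun j _ => X.inner_ract _ _ _
  simp only [h3, Finset.op_sum, map_sum, LinearMap.sum_apply, X.ract_mul_apply]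
  rw [Finset.sum_comm]
  refine Finset.sum_congr rfl fun j _ => ?_
  rw [← map_sum, ← hbj j]

/-- If the number of orthonormal central vectors is bounded, then there is a basis of such
vectors. -/
theorem exists_central_basis (hl : ∀ i, IsLocalized LInf.loc (Finset.Icc p q) (b i))
    (hb : IsProjBasis X.ract X.inner b) (hpq : p ≤ q) (C : ℕ)
    (hC : ∀ (N : ℕ) (ξ : Fin N → X), IsCentralOrthonormal ξ → N ≤ C) :
    ∃ (k : ℕ) (ξ : Fin k → X), IsCentralOrthonormal ξ ∧ IsProjBasis X.ract X.inner ξ := by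
  -- Any unit vector would serve. `K` is the range of `π(|o⟩⟨o|)`, the multiplicity space.
  let o : L2 (Finset.Icc p q → ℕ) := ket 0
  let K : Submodule ℂ (AmplSpace p q n) := LinearMap.eqLocus (localRep hl (rankOne ℂ o o)) LinearMap.id
  have hK : ∀ v : K, localRep hl (rankOne ℂ o o) (v : AmplSpace p q n) = v := fun v => v.2
  have hcent : ∀ {N : ℕ} {v : Fin N → K}, Orthonormal ℂ v →
      IsCentralOrthonormal fun m => centralVec hl hb o (hK (v m)) := fun {N v} hv =>
    ⟨fun m a => centralVec_central hl hb o _ a, fun m m' => by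
      rw [inner_centralVec_centralVec, ← Submodule.coe_inner, orthonormal_iff_ite.1 hv]
      split_ifs <;> simp⟩
  -- The span of any finite independent set in `K` has an orthonormal basis, hence gives that many
  -- orthonormal central vectors; so `C` bounds the dimension.
  have hfin : FiniteDimensional ℂ K := by
    refine Module.rank_lt_aleph0_iff.1 (lt_of_le_of_lt (rank_le (n := C) fun s hs => ?_)
      (Cardinal.natCast_lt_aleph0 (n := C)))
    have h1 := (stdOrthonormalBasis ℂ (Submodule.span ℂ (s : Set K))).orthonormal
    have h2 := h1.comp_linearIsometry (Submodule.subtypeₗᵢ _)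
    have h3 := hC _ _ (hcent h2)
    rwa [finrank_span_finset_eq_card hs] at h3
  let B := stdOrthonormalBasis ℂ K
  refine ⟨_, _, hcent B.orthonormal, isProjBasis_centralVec hl hb hpq (norm_ket _) _ fun u hu => ?_⟩
  have := congrArg (Subtype.val) (B.sum_repr' ⟨u, hu⟩).symm
  simpa using this

end LocalRep

/-! ### Correspondences with a basis of orthonormal central vectors -/

namespace FGCorr
section CentralBasis
variable {A : Type} [CStarAlgebra A] [PartialOrder A] [StarOrderedRing A] {X Y : FGCorr A}

/-- The central vectors of a correspondence. -/
def centralSub (X : FGCorr A) : Submodule ℂ X where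
  carrier := {ξ | ∀ a, X.lact a ξ = X.ract (op a) ξ}
  zero_mem' := fun a => by simp
  add_mem' := fun {ξ η} hξ hη a => by rw [map_add, map_add, hξ, hη]
  smul_mem' := fun z ξ hξ a => by rw [map_smul, map_smul, hξ]

theorem inner_lact_central {ξ : X} (hξ : ξ ∈ centralSub X) (a : A) (x : X) :
    X.inner ξ (X.lact a x) = a * X.inner ξ x := by
  have h := X.inner_lact (star a) ξ x
  rw [star_star] at h
  rw [← h, hξ, ← X.star_inner, X.inner_ract, star_mul, star_star, X.star_inner]

/-- Centrality of `η` moves `a` through it: `ξ a ⊗ η c = ξ ⊗ a η c = ξ ⊗ η a c`. -/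
theorem tens_ract_central {ξ : X} {η : Y} (hη : η ∈ centralSub Y) (a c : A) :
    tens (X.ract (op a) ξ) (Y.ract (op c) η) = (tensor X Y).ract (op (a * c)) (tens ξ η) := by
  rw [ract_tens, Y.lact_ract, hη, ← Y.ract_mul_apply, ract_tens']

theorem tens_mem_centralSub {ξ : X} {η : Y} (hξ : ξ ∈ centralSub X) (hη : η ∈ centralSub Y) :
    tens ξ η ∈ centralSub (tensor X Y) := fun a => by
  rw [lact_tens, hξ, ract_tens, hη, ract_tens']

theorem lin_mem_centralSub (f : X ⟶ Y) {ξ : X} (hξ : ξ ∈ centralSub X) :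
    Hom.lin f ξ ∈ centralSub Y := fun a => by
  rw [← lin_lact, hξ, lin_ract]

/-- Projective bases that consist of orthonormal central vectors. -/
structure IsCentralBasis {k : ℕ} (ξ : Fin k → X) : Prop where
  orthonormal : IsCentralOrthonormal ξ
  basis : IsProjBasis X.ract X.inner ξ

namespace IsCentralBasis
variable {k : ℕ} {ξ : Fin k → X}

theorem mem (h : IsCentralBasis ξ) (n : Fin k) : ξ n ∈ centralSub X := fun a => h.orthonormal.central n a

theorem hom_ext' (h : IsCentralBasis ξ) {f g : X ⟶ Y}
    (hfg : ∀ n, Hom.lin f (ξ n) = Hom.lin g (ξ n)) : f = g :=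
  hom_ext fun x => by
    rw [h.basis x, map_sum, map_sum]
    exact Finset.sum_congr rfl fun n _ => by rw [lin_ract, lin_ract, hfg]

variable (h : IsCentralBasis ξ)

/-- The morphism that maps the central basis to given central vectors. -/
def desc {η : Fin k → Y} (hη : ∀ n, η n ∈ centralSub Y) : X ⟶ Y :=
  mkHom (∑ n, (
       { toFun := fun x => Y.ract (op (X.inner (ξ n) x)) (η n)
         map_add' := fun x x' => by rw [map_add, Y.ract_add_apply]
         map_smul' := fun z x => by rw [map_smul, Y.ract_smul_apply]; rfl } : X →ₗ[ℂ] Y))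
    (fun a x => by
      simp only [LinearMap.sum_apply, LinearMap.coe_mk, AddHom.coe_mk, map_sum]
      refine Finset.sum_congr rfl fun n _ => ?_
      rw [inner_lact_central (h.mem n), Y.ract_mul_apply, ← hη, Y.lact_ract])
    (fun a x => by
      simp only [LinearMap.sum_apply, LinearMap.coe_mk, AddHom.coe_mk, map_sum]
      refine Finset.sum_congr rfl fun n _ => ?_
      obtain ⟨a, rfl⟩ := MulOpposite.op_surjective a
      rw [X.inner_ract, Y.ract_mul_apply])

theorem lin_desc {η : Fin k → Y} (hη : ∀ n, η n ∈ centralSub Y) (x : X) :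
    Hom.lin (h.desc hη) x = ∑ n, Y.ract (op (X.inner (ξ n) x)) (η n) := by
  simp [desc]

theorem lin_desc_basis {η : Fin k → Y} (hη : ∀ n, η n ∈ centralSub Y) (m : Fin k) :
    Hom.lin (h.desc hη) (ξ m) = η m := by
  rw [lin_desc, Finset.sum_eq_single m]
  · rw [h.orthonormal.inner_eq, if_pos rfl, op_one, map_one]; rfl
  · intro n _ hn
    rw [h.orthonormal.inner_eq, if_neg hn, op_zero, map_zero]; rfl
  · simp

/-- Both sides of the adjoint relation equal `∑ ⟨x, ξ n⟩ ⟨η n, y⟩`. This makes `iso` unitary. -/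
theorem dag_desc {η : Fin k → Y} (hη : IsCentralBasis η) :
    dag (h.desc hη.mem) = hη.desc h.mem := hom_ext fun y => ext_inner fun x => by
  rw [← inner_dag, lin_desc, lin_desc, map_sum, map_sum, LinearMap.sum_apply]
  refine Finset.sum_congr rfl fun n _ => ?_
  rw [X.inner_ract, ← Y.star_inner, Y.inner_ract, star_mul, X.star_inner, Y.star_inner]

/-- Correspondences with central bases of the same size are unitarily isomorphic. -/
def iso {η : Fin k → Y} (hη : IsCentralBasis η) : X ≅ Y where
  hom := h.desc hη.mem
  inv := hη.desc h.mem
  hom_inv_id := h.hom_ext' fun n => by rw [lin_comp, lin_desc_basis, lin_desc_basis, lin_id]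
  inv_hom_id := hη.hom_ext' fun n => by rw [lin_comp, lin_desc_basis, lin_desc_basis, lin_id]

/-- The coevaluation `1 ↦ ∑ ξ n ⊗ ξ n`. -/
def coev : unit A ⟶ tensor X X :=
  mkHom { toFun := fun a => (tensor X X).lact a (∑ n, tens (ξ n) (ξ n))
          map_add' := fun a c => (tensor X X).lact_add_apply a c _
          map_smul' := fun z a => (tensor X X).lact_smul_apply z a _ }
    (fun a c => (tensor X X).lact_mul_apply a c _)
    (fun a c => by
      obtain ⟨a, rfl⟩ := MulOpposite.op_surjective a
      have hR : ∑ n, tens (ξ n) (ξ n) ∈ centralSub (tensor X X) :=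
        sum_mem fun n _ => tens_mem_centralSub (h.mem n) (h.mem n)
      have key : ∀ c a : A, (tensor X X).lact (c * a) (∑ n, tens (ξ n) (ξ n)) =
          (tensor X X).ract (op a) ((tensor X X).lact c (∑ n, tens (ξ n) (ξ n))) := fun c a => by
        rw [lact_mul_apply, hR a, (tensor X X).lact_ract]
      exact key c a)

theorem lin_coev (a : A) :
    Hom.lin h.coev (toUnit a) = ∑ n, tens (X.lact a (ξ n)) (ξ n) := by
  change (tensor X X).lact a (∑ n, tens (ξ n) (ξ n)) = _
  rw [map_sum]; rfl

/-- The evaluation `x ⊗ y ↦ ∑ ⟨ξ n, x⟩ ⟨ξ n, y⟩`. -/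
def ev : tensor X X ⟶ unit A :=
  tensorHomMk (Z := unit A)
    (tensLift (fun x y => toUnit (∑ n, X.inner (ξ n) x * X.inner (ξ n) y))
      (fun x x' y => by simp only [map_add, add_mul, Finset.sum_add_distrib]; rfl)
      (fun z x y => by simp only [map_smul, smul_mul_assoc, ← Finset.smul_sum]; rfl)
      (fun x y y' => by simp only [map_add, mul_add, Finset.sum_add_distrib]; rfl)
      (fun z x y => by simp only [map_smul, mul_smul_comm, ← Finset.smul_sum]; rfl)
      -- Balancedness needs central `ξ n`: `⟨ξ n, x⟩ a ⟨ξ n, y⟩ = ⟨ξ n, x⟩ ⟨ξ n, a y⟩`.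
      (fun x a y => congrArg toUnit (Finset.sum_congr rfl fun n _ => by
        rw [X.inner_ract, inner_lact_central (h.mem n), mul_assoc])))
    (fun a x y => by
      change (∑ n, X.inner (ξ n) (X.lact a x) * X.inner (ξ n) y) =
        a * ∑ n, X.inner (ξ n) x * X.inner (ξ n) y
      rw [Finset.mul_sum]
      exact Finset.sum_congr rfl fun n _ => by rw [inner_lact_central (h.mem n), mul_assoc])
    (fun a x y => by
      obtain ⟨a, rfl⟩ := MulOpposite.op_surjective a
      change (∑ n, X.inner (ξ n) x * X.inner (ξ n) (X.ract (op a) y)) =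
        (∑ n, X.inner (ξ n) x * X.inner (ξ n) y) * a
      rw [Finset.sum_mul]
      exact Finset.sum_congr rfl fun n _ => by rw [X.inner_ract, mul_assoc])

theorem lin_ev_basis (x : X) (m : Fin k) :
    Hom.lin h.ev (tens x (ξ m)) = toUnit (X.inner (ξ m) x) := by
  change toUnit (∑ n, X.inner (ξ n) x * X.inner (ξ n) (ξ m)) = _
  rw [Finset.sum_eq_single m]
  · rw [h.orthonormal.inner_eq, if_pos rfl, mul_one]
  · intro n _ hn
    rw [h.orthonormal.inner_eq, if_neg hn, mul_zero]
  · simp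

theorem lin_ev_basis_left (x : X) (m : Fin k) :
    Hom.lin h.ev (tens (ξ m) x) = toUnit (X.inner (ξ m) x) := by
  change toUnit (∑ n, X.inner (ξ n) (ξ m) * X.inner (ξ n) x) = _
  rw [Finset.sum_eq_single m]
  · rw [h.orthonormal.inner_eq, if_pos rfl, one_mul]
  · intro n _ hn
    rw [h.orthonormal.inner_eq, if_neg hn, zero_mul]
  · simp

end IsCentralBasis

theorem sum_tens {n : ℕ} (x : Fin n → X) (y : Y) : tens (∑ i, x i) y = ∑ i, tens (x i) y :=
  sum_tmul x y
theorem tens_sum {n : ℕ} (x : X) (y : Fin n → Y) : tens x (∑ i, y i) = ∑ i, tens x (y i) :=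
  tmul_sum x y

theorem assoc_inv_tens {Z : FGCorr A} (x : X) (y : Y) (z : Z) :
    Hom.lin (assoc X Y Z).inv (tens x (tens y z)) = tens (tens x y) z := rfl

/-- The zigzag composite is the basis expansion `x = ∑ ξ n ⟨ξ n, x⟩`. -/
theorem IsCentralBasis.coev_ev {k : ℕ} {ξ : Fin k → X} (h : IsCentralBasis ξ) (x : X) (a : A) :
    Hom.lin (leftUnit X).hom (Hom.lin (tensorMap h.ev (𝟙 X))
      (Hom.lin (assoc X X X).inv (tens x (Hom.lin h.coev (toUnit a))))) = X.ract (op a) x := by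
  rw [h.lin_coev, tens_sum, map_sum, map_sum, map_sum]
  conv_rhs => rw [h.basis x, map_sum]
  refine Finset.sum_congr rfl fun n _ => ?_
  rw [assoc_inv_tens, tensorMap_tens, h.mem n a, ← ract_tens', lin_ract, h.lin_ev_basis]
  change X.lact (X.inner (ξ n) x * a) (ξ n) = _
  rw [h.mem n _, X.ract_mul_apply]

theorem IsCentralBasis.ev_coev {k : ℕ} {ξ : Fin k → X} (h : IsCentralBasis ξ) (a : A) (x : X) :
    Hom.lin (rightUnit X).hom (Hom.lin (tensorMap (𝟙 X) h.ev)
      (Hom.lin (assoc X X X).hom (tens (Hom.lin h.coev (toUnit a)) x))) = X.lact a x := by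
  rw [h.lin_coev, sum_tens, map_sum, map_sum, map_sum]
  conv_rhs => rw [h.basis x, map_sum]
  refine Finset.sum_congr rfl fun n _ => ?_
  rw [assoc_hom_tens, tensorMap_tens, h.lin_ev_basis_left, lin_id, rightUnit_hom_tens, X.lact_ract]

/-- A correspondence with a central basis is its own dual. -/
@[reducible]
def IsCentralBasis.exactPairing {k : ℕ} {ξ : Fin k → X} (h : IsCentralBasis ξ) :
    ExactPairing X X where
  coevaluation' := h.coev
  evaluation' := h.ev
  coevaluation_evaluation' := by
    rw [Iso.eq_comp_inv]
    exact tensor_hom_ext (X := X) (Y := unit A) fun x a => h.coev_ev x a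
  evaluation_coevaluation' := by
    rw [Iso.eq_comp_inv]
    exact tensor_hom_ext (X := unit A) (Y := X) fun a x => h.ev_coev a x

theorem isCentralBasis_free (k : ℕ) :
    IsCentralBasis (X := free A k) fun i : Fin k => (Pi.single i (1 : A) : Fin k → A) where
  orthonormal := ⟨fun n a => by
      refine funext fun i => ?_
      change a * (Pi.single n (1 : A) : Fin k → A) i = (Pi.single n (1 : A) : Fin k → A) i * a
      by_cases hi : i = n <;> simp [hi], fun m n => by
      change freeInner k _ _ = _
      rw [freeInner_apply]
      simp only [Pi.single_apply, apply_ite star, star_one, star_zero, ite_mul, one_mul, zero_mul,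
        Finset.sum_ite_eq', Finset.mem_univ, if_true]⟩
  basis := free_basis k

theorem isCentralBasis_unit : IsCentralBasis (X := unit A) fun _ : Fin 1 => toUnit (1 : A) where
  orthonormal := ⟨fun n a => mem_commSub_unit.2 (by rw [mul_one, one_mul]), fun m n => by
      rw [if_pos (Subsingleton.elim _ _)]
      change star (1 : A) * 1 = 1
      simp⟩
  basis := unit_basis

end CentralBasis
end FGCorr

open FGCorr

/-! ### The Hilbert space of central vectors -/

section CentralSpace

theorem vac_star_mul_self_nonneg (c : LInf) : 0 ≤ (vac (star c * c)).re := by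
  have : vac (star c * c) = ⟪LInf.incl c (ket 0), LInf.incl c (ket 0)⟫_ℂ := by
    change ⟪ket 0, LInf.incl (star c * c) (ket 0)⟫_ℂ = _
    rw [map_mul, map_star, mul_apply_eq_comp, ContinuousLinearMap.star_eq_adjoint,
      ContinuousLinearMap.adjoint_inner_right]
  rw [this]
  exact inner_self_nonneg (𝕜 := ℂ)

variable (X : FGCorr LInf)

/-- Inner products of central vectors lie in the center, hence are scalars; the vacuum state only
reads off the scalar. -/
theorem inner_eq_vac {X : FGCorr LInf} {ξ η : X} (hξ : ξ ∈ centralSub X) (hη : η ∈ centralSub X) :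
    X.inner ξ η = vac (X.inner ξ η) • 1 :=
  eq_vac_of_central fun b => commute_inner (hξ (star b)) (hη b)

/-- The Hilbert space structure on the central vectors. -/
@[reducible]
def centralCore : InnerProductSpace.Core ℂ (centralSub X) where
  inner ξ η := vac (X.inner ξ η)
  conj_inner_symm ξ η := by
    change star (vac (X.inner η ξ)) = vac (X.inner ξ η)
    rw [← vac_star, X.star_inner]
  re_inner_nonneg ξ := by
    obtain ⟨c, hc⟩ := CStarAlgebra.nonneg_iff_eq_star_mul_self.1 (X.inner_self_nonneg ξ)
    change 0 ≤ (vac (X.inner ξ ξ)).re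
    rw [hc]
    exact vac_star_mul_self_nonneg c
  add_left ξ ξ' η := by
    change vac (X.inner (ξ + ξ' : X) η) = _
    rw [map_add, LinearMap.add_apply, map_add]
  smul_left ξ η z := by
    change vac (X.inner (z • ξ : X) η) = _
    rw [map_smulₛₗ, LinearMap.smul_apply, map_smul]; rfl
  definite ξ hξ := by
    change vac (X.inner ξ ξ) = 0 at hξ
    refine Subtype.ext (X.inner_self_eq_zero _ ?_)
    rw [inner_eq_vac ξ.2 ξ.2, hξ, zero_smul]

instance : NormedAddCommGroup (centralSub X) := (centralCore X).toNormedAddCommGroup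
instance : InnerProductSpace ℂ (centralSub X) := InnerProductSpace.ofCore (centralCore X).toCore

variable {X} {Y : FGCorr LInf}

theorem central_inner (ξ η : centralSub X) : ⟪ξ, η⟫_ℂ = vac (X.inner ξ η) := rfl

theorem inner_eq_central (ξ η : centralSub X) : X.inner ξ η = ⟪ξ, η⟫_ℂ • 1 :=
  inner_eq_vac ξ.2 η.2

/-- A central basis is an orthonormal basis of the space of central vectors. -/
theorem FGCorr.IsCentralBasis.sum_eq {k : ℕ} {ξ : Fin k → X} (h : IsCentralBasis ξ) {η : X}
    (hη : η ∈ centralSub X) : η = ∑ n, vac (X.inner (ξ n) η) • ξ n := by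
  conv_lhs => rw [h.basis η]
  refine Finset.sum_congr rfl fun n _ => ?_
  conv_lhs => rw [inner_eq_vac (h.mem n) hη, X.ract_smul_apply, op_one, map_one]
  rfl

/-- Coordinates with respect to a central basis. -/
def FGCorr.IsCentralBasis.equiv {k : ℕ} {ξ : Fin k → X} (h : IsCentralBasis ξ) :
    centralSub X ≃ₗ[ℂ] (Fin k → ℂ) where
  toFun η := fun n => vac (X.inner (ξ n) η)
  map_add' η η' := by
    funext n
    change vac (X.inner (ξ n) (η + η' : X)) = _
    rw [map_add, map_add]; rfl
  map_smul' z η := by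
    funext n
    change vac (X.inner (ξ n) (z • η : X)) = _
    rw [map_smul, map_smul]; rfl
  invFun c := ⟨∑ n, c n • ξ n, sum_mem fun n _ => Submodule.smul_mem _ _ (h.mem n)⟩
  left_inv η := Subtype.ext (h.sum_eq η.2).symm
  right_inv c := by
    funext m
    change vac (X.inner (ξ m) (∑ n, c n • ξ n)) = c m
    rw [map_sum, Finset.sum_eq_single m]
    · rw [map_smul, h.orthonormal.inner_eq, if_pos rfl, map_smul, vac_one, smul_eq_mul, mul_one]
    · intro n _ hn
      rw [map_smul, h.orthonormal.inner_eq, if_neg hn.symm, smul_zero]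
    · simp

/-- The restriction of a morphism to the central vectors. -/
def centMap (f : X ⟶ Y) : centralSub X →ₗ[ℂ] centralSub Y :=
  (Hom.lin f).restrict fun _ hξ => lin_mem_centralSub f hξ

theorem adjoint_centMap (f : X ⟶ Y) (ξ : centralSub X) (η : centralSub Y) :
    ⟪centMap f ξ, η⟫_ℂ = ⟪ξ, centMap (dag f) η⟫_ℂ :=
  congrArg vac (inner_dag f (ξ : X) (η : Y))

/-- A bimodule map can be prescribed freely on a central basis, and it is determined on all central
vectors by linearity. This gives fullness. -/
theorem FGCorr.IsCentralBasis.exists_centMap {k : ℕ} {ξ : Fin k → X} (h : IsCentralBasis ξ)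
    (φ : centralSub X →ₗ[ℂ] centralSub Y) : ∃ f : X ⟶ Y, centMap f = φ := by
  refine ⟨h.desc (η := fun n => φ ⟨ξ n, h.mem n⟩) fun n => (φ _).2, ?_⟩
  refine LinearMap.ext fun η => ?_
  have h1 : η = ∑ n, vac (X.inner (ξ n) η) • (⟨ξ n, h.mem n⟩ : centralSub X) :=
    Subtype.ext (by rw [Submodule.coe_sum]; exact h.sum_eq η.2)
  rw [h1, map_sum, map_sum]
  refine Finset.sum_congr rfl fun n _ => ?_
  rw [map_smul, map_smul]
  congr 1
  exact Subtype.ext (h.lin_desc_basis _ n)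

variable (X Y) in
/-- The map `ξ ⊗ η ↦ ξ ⊗ η` from the tensor product of the spaces of central vectors. -/
def centTens : centralSub X ⊗[ℂ] centralSub Y →ₗ[ℂ] centralSub (tensor X Y) :=
  TensorProduct.lift (LinearMap.mk₂ ℂ
    (fun ξ η => ⟨tens (ξ : X) (η : Y), tens_mem_centralSub ξ.2 η.2⟩)
    (fun ξ ξ' η => Subtype.ext (add_tens (ξ : X) ξ' (η : Y)))
    (fun z ξ η => Subtype.ext (smul_tens z (ξ : X) (η : Y)))
    (fun ξ η η' => Subtype.ext (tens_add (ξ : X) (η : Y) η'))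
    (fun z ξ η => Subtype.ext (tens_smul z (ξ : X) (η : Y))))

theorem centTens_tmul (ξ : centralSub X) (η : centralSub Y) :
    (centTens X Y (ξ ⊗ₜ η) : tensor X Y) = tens (ξ : X) (η : Y) := rfl

/-- In `⟨η, ⟨ξ, ξ'⟩ η'⟩` the inner factor is a scalar and comes out. Injectivity and unitarity of
the tensorator follow. -/
theorem inner_centTens (s t : centralSub X ⊗[ℂ] centralSub Y) :
    ⟪centTens X Y s, centTens X Y t⟫_ℂ = ⟪s, t⟫_ℂ := by
  induction s with
  | zero => simp
  | add s s' hs hs' => rw [map_add, inner_add_left, inner_add_left, hs, hs']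
  | tmul ξ η =>
    induction t with
    | zero => simp
    | add t t' ht ht' => rw [map_add, inner_add_right, inner_add_right, ht, ht']
    | tmul ξ' η' =>
      rw [TensorProduct.inner_tmul, central_inner, centTens_tmul, centTens_tmul, inner_tens,
        inner_eq_central, lact_smul_apply, map_one, map_smul, map_smul]
      rfl

theorem centTens_injective : Function.Injective (centTens X Y) := by
  rw [injective_iff_map_eq_zero]
  intro s hs
  rw [← inner_self_eq_zero (𝕜 := ℂ), ← inner_centTens, hs, inner_zero_left]

/-- The vectors `ξ m ⊗ η n` are central and form a projective basis, and the coefficients of a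
central `t` in it are scalars. -/
theorem centTens_surjective {k l : ℕ} {ξ : Fin k → X} {η : Fin l → Y} (hξ : IsCentralBasis ξ)
    (hη : IsCentralBasis η) : Function.Surjective (centTens X Y) := by
  intro t
  have h := Bal.basis hξ.basis hη.basis t.1
  refine ⟨∑ m, vac ((tensor X Y).inner (tens (ξ (finProdFinEquiv.symm m).1)
    (η (finProdFinEquiv.symm m).2)) t) • ((⟨ξ (finProdFinEquiv.symm m).1, hξ.mem _⟩ : centralSub X) ⊗ₜ
      (⟨η (finProdFinEquiv.symm m).2, hη.mem _⟩ : centralSub Y)), Subtype.ext ?_⟩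
  rw [map_sum, Submodule.coe_sum]
  refine Eq.trans (Finset.sum_congr rfl fun m _ => ?_) h.symm
  have h1 := inner_eq_vac (X := tensor X Y) (tens_mem_centralSub (hξ.mem (finProdFinEquiv.symm m).1)
    (hη.mem (finProdFinEquiv.symm m).2)) t.2
  rw [map_smul, Submodule.coe_smul, centTens_tmul]
  refine Eq.trans ?_ (congrArg (fun a => (tensor X Y).ract (op a)
    (tens (ξ (finProdFinEquiv.symm m).1) (η (finProdFinEquiv.symm m).2))) h1.symm)
  simp only []
  rw [ract_smul_apply, op_one, map_one]
  rfl

end CentralSpace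

open FGCorr MonoidalCategory

/-! ### The unitary braided equivalence with finite-dimensional Hilbert spaces -/

section Equivalence

theorem exists_isCentralBasis (X : DHR₀ LInf.loc) :
    ∃ (k : ℕ) (ξ : Fin k → X.corr), IsCentralBasis ξ := by
  obtain ⟨Y, ⟨hY⟩⟩ := X.property.1
  obtain ⟨R, hR⟩ := X.obj.property
  -- The interval `[1, R + 1]` is long enough, and it is nonempty even if `R = 0`.
  obtain ⟨n, b, hb, hl⟩ := hR 1 (R + 1) (by simp)
  have hz := congrArg (fun f => f.hom) (ExactPairing.evaluation_coevaluation X.obj Y)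
  have hbound := fun (N : ℕ) (ξ : Fin N → X.corr) (hξ : IsCentralOrthonormal ξ) =>
    card_le_of_dual (X := X.corr) (Y := Y.obj) (η_ X.obj Y).hom (ε_ X.obj Y).hom hz hξ
  obtain ⟨C, hC⟩ := exists_nat_ge ‖(tensor X.corr Y.obj).inner
    (Hom.lin (η_ X.obj Y).hom (toUnit 1)) (Hom.lin (η_ X.obj Y).hom (toUnit 1)) +
    (tensor Y.obj X.corr).inner (Hom.lin (dag (ε_ X.obj Y).hom) (toUnit 1))
      (Hom.lin (dag (ε_ X.obj Y).hom) (toUnit 1))‖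
  obtain ⟨k, ξ, h1, h2⟩ := exists_central_basis (X := X.corr) hl hb (by omega) C fun N ξ hξ => by
    have h3 : (2 * N : ℝ) ≤ C := (hbound N ξ hξ).trans hC
    have h4 : (N : ℝ) ≤ C := by linarith [Nat.cast_nonneg (α := ℝ) N]
    exact_mod_cast h4
  exact ⟨k, ξ, h1, h2⟩

instance (X : DHR₀ LInf.loc) : FiniteDimensional ℂ (centralSub X.corr) := by
  obtain ⟨k, ξ, h⟩ := exists_isCentralBasis X
  exact Module.Finite.equiv h.equiv.symm

/-- The functor that maps a DHR bimodule to its space of central vectors. -/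
def centralFunctor : DHR₀ LInf.loc ⥤ HilbFd where
  obj X := ⟨centralSub X.corr⟩
  map f := centMap f.hom.hom

instance : centralFunctor.Faithful where
  map_injective {X Y f g} hfg := by
    obtain ⟨k, ξ, h⟩ := exists_isCentralBasis X
    refine ObjectProperty.hom_ext _ (ObjectProperty.hom_ext _ (h.hom_ext' fun n => ?_))
    exact congrArg Subtype.val (LinearMap.congr_fun
      (show centMap f.hom.hom = centMap g.hom.hom from hfg) ⟨ξ n, h.mem n⟩)

instance : centralFunctor.Full where
  map_surjective {X Y} φ := by
    obtain ⟨k, ξ, h⟩ := exists_isCentralBasis X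
    obtain ⟨f, hf⟩ := h.exists_centMap (Y := Y.corr) (HilbFd.lin φ)
    exact ⟨ObjectProperty.homMk (ObjectProperty.homMk f), hf⟩

theorem isDHR_of_isCentralBasis {X : FGCorr LInf} {k : ℕ} {ξ : Fin k → X} (h : IsCentralBasis ξ) :
    IsDHR LInf.loc X :=
  ⟨0, fun _ _ _ => ⟨k, ξ, h.basis, fun n a _ => h.mem n a⟩⟩

theorem isDualizable_of_isCentralBasis {X : DHR LInf.loc} {k : ℕ} {ξ : Fin k → X.obj}
    (h : IsCentralBasis ξ) : IsDualizable LInf.loc X := by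
  -- The self-duality in the category of correspondences is reflected by the fully faithful
  -- inclusion of the DHR bimodules.
  let : ExactPairing ((IsDHR LInf.loc).ι.obj X) ((IsDHR LInf.loc).ι.obj X) := h.exactPairing
  have := ExactPairing.ofFullyFaithful (IsDHR LInf.loc).ι X X
  exact ⟨⟨X, ⟨this⟩⟩, ⟨X, ⟨this⟩⟩⟩

/-- The free bimodule as a dualizable DHR bimodule. -/
def freeDHR (k : ℕ) : DHR₀ LInf.loc :=
  ⟨⟨free LInf k, isDHR_of_isCentralBasis (isCentralBasis_free k)⟩,
    isDualizable_of_isCentralBasis (isCentralBasis_free k)⟩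

instance : centralFunctor.EssSurj where
  mem_essImage E := by
    have e : centralSub (free LInf (Module.finrank ℂ E)) ≃ₗ[ℂ] E :=
      (isCentralBasis_free _).equiv.trans (Module.finBasis ℂ E).equivFun.symm
    exact ⟨freeDHR (Module.finrank ℂ E), ⟨HilbFd.isoMk
      (E := centralFunctor.obj (freeDHR (Module.finrank ℂ E))) e⟩⟩

instance : centralFunctor.IsEquivalence where

/-- The tensorator. -/
def centTensEquiv (X Y : DHR₀ LInf.loc) :
    centralSub X.corr ⊗[ℂ] centralSub Y.corr ≃ₗ[ℂ] centralSub (tensor X.corr Y.corr) :=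
  LinearEquiv.ofBijective (centTens X.corr Y.corr) ⟨centTens_injective, by
    obtain ⟨k, ξ, hξ⟩ := exists_isCentralBasis X
    obtain ⟨l, η, hη⟩ := exists_isCentralBasis Y
    exact centTens_surjective hξ hη⟩

theorem unit_mem_centralSub (z : ℂ) : z • toUnit (1 : LInf) ∈ centralSub (unit LInf) :=
  Submodule.smul_mem _ _ (isCentralBasis_unit.mem 0)

/-- The unit isomorphism. -/
def centUnitEquiv : ℂ ≃ₗ[ℂ] centralSub (unit LInf) :=
  LinearEquiv.ofBijective
    { toFun := fun z => ⟨z • toUnit 1, unit_mem_centralSub z⟩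
      map_add' := fun z w => Subtype.ext (add_smul z w _)
      map_smul' := fun z w => Subtype.ext (mul_smul z w _) }
    ⟨fun z w hzw => by
      have h : z • (1 : LInf) = w • 1 := congrArg Subtype.val hzw
      have h' := congrArg vac h
      simpa [vac_one] using h',
    fun η => ⟨_, Subtype.ext (by
      have h := isCentralBasis_unit.sum_eq η.2
      rw [Fin.sum_univ_one] at h
      exact h.symm)⟩⟩

/-- Compatibility with the unitors compares scalar multiplication with the action of `z • 1`. -/
theorem smul_eq_lact {X : FGCorr LInf} (z : ℂ) (x : X) : z • x = X.lact (z • 1) x := by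
  rw [map_smul, map_one]; rfl

theorem smul_eq_ract {X : FGCorr LInf} (z : ℂ) (x : X) : z • x = X.ract (op (z • 1)) x := by
  rw [op_smul, map_smul, op_one, map_one]; rfl

/-- The tensor structure of `centralFunctor`. -/
def centralCoreMonoidal : centralFunctor.CoreMonoidal where
  εIso := HilbFd.isoMk (E := 𝟙_ HilbFd) (F := centralFunctor.obj (𝟙_ _)) centUnitEquiv
  μIso X Y := HilbFd.isoMk (E := centralFunctor.obj X ⊗ centralFunctor.obj Y)
    (F := centralFunctor.obj (X ⊗ Y)) (centTensEquiv X Y)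
  μIso_hom_natural_left _ _ := TensorProduct.ext' fun _ _ => rfl
  μIso_hom_natural_right _ _ := TensorProduct.ext' fun _ _ => rfl
  associativity _ _ _ := TensorProduct.ext_threefold fun _ _ _ => rfl
  left_unitality _ := TensorProduct.ext' fun z ξ => Subtype.ext (smul_eq_lact z ξ.1)
  right_unitality _ := TensorProduct.ext' fun ξ z => Subtype.ext (smul_eq_ract z ξ.1)

instance : centralFunctor.Monoidal := centralCoreMonoidal.toMonoidal

instance : centralFunctor.Additive where
  map_add := rfl

instance : centralFunctor.Linear ℂ where
  map_smul _ _ := rfl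

open Functor.LaxMonoidal Functor.OplaxMonoidal

theorem HilbFd.dagger_eq {E F : HilbFd} {f : E ⟶ F} {g : F ⟶ E}
    (h : ∀ x y, ⟪HilbFd.lin g x, y⟫_ℂ = ⟪x, HilbFd.lin f y⟫_ℂ) : DaggerCategory.dagger f = g :=
  ((LinearMap.eq_adjoint_iff (HilbFd.lin g) (HilbFd.lin f)).2 h).symm

theorem inner_centUnitEquiv (t s : ℂ) : ⟪t, s⟫_ℂ = ⟪centUnitEquiv t, centUnitEquiv s⟫_ℂ := by
  change s * star t = vac (star (t • (1 : LInf)) * (s • (1 : LInf)))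
  rw [star_smul, star_one, smul_mul_smul_comm, one_mul, map_smul, vac_one, smul_eq_mul, mul_one,
    mul_comm]

theorem inner_centUnitEquiv_symm (t : centralSub (unit LInf)) (s : ℂ) :
    ⟪centUnitEquiv.symm t, s⟫_ℂ = ⟪t, centUnitEquiv s⟫_ℂ := by
  rw [inner_centUnitEquiv, LinearEquiv.apply_symm_apply]

theorem inner_centTensEquiv_symm {X Y : DHR₀ LInf.loc} (t : centralSub (tensor X.corr Y.corr))
    (s : centralSub X.corr ⊗[ℂ] centralSub Y.corr) :
    ⟪(centTensEquiv X Y).symm t, s⟫_ℂ = ⟪t, centTensEquiv X Y s⟫_ℂ := by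
  obtain ⟨t, rfl⟩ := (centTensEquiv X Y).surjective t
  rw [LinearEquiv.symm_apply_apply]
  exact (inner_centTens t s).symm

theorem inner_centMap_dag {X Y : FGCorr LInf} (f : X ⟶ Y) (η : centralSub Y) (ξ : centralSub X) :
    ⟪centMap (dag f) η, ξ⟫_ℂ = ⟪η, centMap f ξ⟫_ℂ := by
  rw [← inner_conj_symm, ← adjoint_centMap, inner_conj_symm]

/-- The tensorator and the unit map are isometric bijections, so their adjoints are their inverses.
-/
theorem isUnitaryTensorFunctor_central : IsUnitaryTensorFunctor centralFunctor where
  map_dagger {X Y} f := (HilbFd.dagger_eq (E := centralFunctor.obj X) (F := centralFunctor.obj Y)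
    (f := centralFunctor.map f) (g := centralFunctor.map (DaggerCategory.dagger f))
    (inner_centMap_dag f.hom.hom)).symm
  dagger_μ X Y := HilbFd.dagger_eq (E := centralFunctor.obj X ⊗ centralFunctor.obj Y)
    (F := centralFunctor.obj (X ⊗ Y)) (f := μ centralFunctor X Y) (g := δ centralFunctor X Y)
    inner_centTensEquiv_symm
  dagger_ε := HilbFd.dagger_eq (E := 𝟙_ HilbFd) (F := centralFunctor.obj (𝟙_ _))
    (f := ε centralFunctor) (g := η centralFunctor) inner_centUnitEquiv_symm

/-- The braiding transported from finite-dimensional Hilbert spaces. -/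
instance : BraidedCategory (DHR₀ LInf.loc) := BraidedCategory.ofFullyFaithful centralFunctor

instance : centralFunctor.Braided where
  braided X Y := by
    change μ centralFunctor X Y ≫ centralFunctor.map (centralFunctor.preimage
      (δ centralFunctor X Y ≫ (β_ (centralFunctor.obj X) (centralFunctor.obj Y)).hom ≫
        μ centralFunctor Y X)) = _
    rw [Functor.map_preimage, Functor.Monoidal.μ_δ_assoc]

theorem braiding_tens_central {X Y : DHR₀ LInf.loc} {ξ : X.corr} {η : Y.corr}
    (hξ : ξ ∈ centralSub X.corr) (hη : η ∈ centralSub Y.corr) :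
    Hom.lin (β_ X Y).hom.hom.hom (tens ξ η) = tens η ξ :=
  congrArg Subtype.val (LinearMap.congr_fun
    (show (centMap (β_ X Y).hom.hom.hom) ∘ₗ centTens X.corr Y.corr =
      centTens Y.corr X.corr ∘ₗ (TensorProduct.comm ℂ _ _).toLinearMap from
        Functor.LaxBraided.braided (F := centralFunctor) X Y)
    ((⟨ξ, hξ⟩ : centralSub X.corr) ⊗ₜ (⟨η, hη⟩ : centralSub Y.corr)))

/-- A morphism that flips central vectors flips vectors localized in disjoint intervals. -/
theorem flip_of_isLocalized {X Y : FGCorr LInf} {k l : ℕ} {ξ : Fin k → X} {η : Fin l → Y}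
    (hξ : IsCentralBasis ξ) (hη : IsCentralBasis η) {f : tensor X Y ⟶ tensor Y X}
    (hf : ∀ m n, Hom.lin f (tens (ξ m) (η n)) = tens (η n) (ξ m)) {p q r s : ℤ}
    (hdisj : Disjoint (Finset.Icc p q) (Finset.Icc r s)) {x : X} {y : Y}
    (hx : IsLocalized LInf.loc (Finset.Icc p q) x) (hy : IsLocalized LInf.loc (Finset.Icc r s) y) :
    Hom.lin f (tens x y) = tens y x := by
  -- Central vectors are localized in every interval, so the coefficients of `x` and `y` lie in the
  -- two local algebras and commute. The expansions of `x ⊗ y` and `y ⊗ x` carry these coefficients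
  -- in opposite orders.
  have hc : ∀ m n, X.inner (ξ m) x * Y.inner (η n) y = Y.inner (η n) y * X.inner (ξ m) x :=
    fun m n => commute_of_mem_loc hdisj (inner_mem_loc (fun a _ => hξ.mem m a) hx)
      (inner_mem_loc (fun a _ => hη.mem n a) hy)
  have hxy : tens x y = ∑ m, ∑ n, (tensor X Y).ract (op (X.inner (ξ m) x * Y.inner (η n) y))
      (tens (ξ m) (η n)) := by
    conv_lhs => rw [hξ.basis x, hη.basis y]
    simp only [sum_tens, tens_sum, tens_ract_central (hη.mem _)]
    exact Finset.sum_comm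
  have hyx : tens y x = ∑ m, ∑ n, (tensor Y X).ract (op (X.inner (ξ m) x * Y.inner (η n) y))
      (tens (η n) (ξ m)) := by
    conv_lhs => rw [hξ.basis x, hη.basis y]
    simp only [sum_tens, tens_sum, tens_ract_central (hξ.mem _), hc]
  rw [hxy, hyx]
  simp only [map_sum, lin_ract, hf]

theorem isDHRBraiding_central : IsDHRBraiding LInf.loc := by
  intro X Y
  -- Distance `0` suffices: `i < j` for all sites already makes the intervals disjoint.
  refine ⟨0, fun p q r s hpq x y hx hy => ?_⟩
  obtain ⟨k, ξ, hξ⟩ := exists_isCentralBasis X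
  obtain ⟨l, η, hη⟩ := exists_isCentralBasis Y
  exact flip_of_isLocalized hξ hη (fun m n => braiding_tens_central (hξ.mem m) (hη.mem n))
    (Finset.disjoint_left.2 fun i hi hj => by simpa using hpq i hi i hj) hx hy

end Equivalence

end RotorChain
end

theorem mainTheorem8 :
    (∀ X : RotorChain.DHR₀ RotorChain.LInf.loc,
      ∃ (k : ℕ) (u : X.corr ≅ RotorChain.FGCorr.free RotorChain.LInf k),
        RotorChain.DaggerCategory.dagger u.hom = u.inv) ∧
    ∃ (_ : CategoryTheory.BraidedCategory (RotorChain.DHR₀ RotorChain.LInf.loc))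
      (F : RotorChain.DHR₀ RotorChain.LInf.loc ⥤ RotorChain.HilbFd) (_ : F.Braided),
      RotorChain.IsDHRBraiding RotorChain.LInf.loc ∧ F.IsEquivalence ∧ F.Additive ∧ F.Linear ℂ ∧
        RotorChain.IsUnitaryTensorFunctor F := by
  refine ⟨fun X => ?_, inferInstance, RotorChain.centralFunctor, inferInstance,
    RotorChain.isDHRBraiding_central, inferInstance, inferInstance, inferInstance,
    RotorChain.isUnitaryTensorFunctor_central⟩
  obtain ⟨k, ξ, h⟩ := RotorChain.exists_isCentralBasis X
  exact ⟨k, h.iso (RotorChain.FGCorr.isCentralBasis_free k),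
    h.dag_desc (RotorChain.FGCorr.isCentralBasis_free k)⟩
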